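/- Let $D\subset\mathbb R^d$ be a nonempty, connected open set and $T>0$. For a path $w$ on $[0,T]$ put $\|w\|_{\infty,[s,t]}=\max_{s\le u\le v\le t}|w_u-w_v|$, and let $\|w\|_{[s,t]}$ be the total variation of $w$ on $[s,t]$. For $x\in\partial D$ let $\mathcal N_x=\bigcup_{r>0}\mathcal N_{x,r}$, where $\mathcal N_{x,r}=\{n\in\mathbb R^d: |n|=1,\ B(x-rn,r)\cap D=\emptyset\}$ and $B(z,r)$ is the open ball. For a continuous path $w$ on $[0,T]$ with $w_0\in\bar D$, a solution of the Skorohod problem associated with $w$ is a pair $(\xi,\phi)$, with $\phi$ continuous of bounded variation, such that for all $0\le t\le T$ $$\xi_t=w_t+\phi(t)\in\bar D,\qquad \phi(t)=\int_0^t 1_{\partial D}(\xi_s)\,n(s)\,d\|\phi\|_{[0,s]},$$ for some $n$ (for which the integral makes sense) with $n(s)\in\mathcal N_{\xi_s}$ whenever $\xi_s\in\partial D$. If it is unique we write $\phi=L(w)$. Consider the following conditions. (A) There is $r_0>0$ such that $\mathcal N_x=\mathcal N_{x,r_0}\neq\emptyset$ for all $x\in\partial D$. (H1) (A) holds, the Skorohod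 problem is uniquely solvable for every continuous $w$ on $[0,T]$ with $w_0\in\bar D$, and there is $C_D>0$ such that $\|L(w)\|_{[s,t]}\le C_D\|w\|_{\infty,[s,t]}$ for all such $w$ and all $0\le s\le t\le T$. (H2) (A) holds, the Skorohod problem is uniquely solvable for every continuous $w$ on $[0,T]$ with $w_0\in\bar D$, and there is $C_D'>0$ such that $\|L(w)-L(w')\|_{\infty,[0,t]}\le C_D'\{\|w-w'\|_{[0,t]}+|w_0-w_0'|\}$ for all such $w,w'$ and all $0\le t\le T$. **Lemma.** Let $\eta$ be a continuous path on $[0,T]$ in $\mathbb R^d$ with $\eta_0=0$, let $x$ be a continuous path on $[0,T]$ in $\mathbb R^n$ of finite $p$-variation for some $p\ge1$ with $x_0=0$, let $F:\mathbb R^d\otimes\mathbb R^n\to\mathbb R^d$ be linear, and let $y_0\in\bar D$. Consider the implicit Skorohod equation $$y_t=y_0+\eta_t+F\Big(\int_0^t\Phi(r)\otimes dx_r\Big)+\Phi(t),\qquad y_t\in\bar D,\qquad 0\le t\le T,$$ where $\Phi$ is a continuous path of bounded variation with $\Phi(0)=0$ and $$\Phi=L\Big(y_0+\eta_\cdot+F\Big(\int_0^\cdot\Phi(r)\otimes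 dx_r\Big)\Big)\quad\text{on }[0,T],$$ the integrals being Young (Riemann–Stieltjes) integrals. (1) If (H2) holds and $x$ has bounded variation on $[0,T]$, then there exists a unique solution $(y,\Phi)$ on $[0,T]$. (2) If (H1) holds, then there exists a solution $(y,\Phi)$ on $[0,T]$. -/

import Mathlib

open Set MeasureTheory
open scoped ENNReal NNReal TensorProduct

/-- Euclidean space of dimension `d` with the Euclidean norm. -/
abbrev Euc (d : ℕ) : Type := EuclideanSpace ℝ (Fin d)

/-! ### Geometry of the domain -/

/-- `𝒩_{x,r}`: the unit vectors `n` such that the open ball `B(x - r n, r)` does not meet `D`. -/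
def inwardNormalsAt {d : ℕ} (D : Set (Euc d)) (x : Euc d) (r : ℝ) : Set (Euc d) :=
  {n | ‖n‖ = 1 ∧ Metric.ball (x - r • n) r ∩ D = ∅}

/-- `𝒩_x = ⋃_{r > 0} 𝒩_{x,r}`: the inward unit normal vectors of `D` at `x`. -/
def inwardNormals {d : ℕ} (D : Set (Euc d)) (x : Euc d) : Set (Euc d) :=
  {n | ∃ r : ℝ, 0 < r ∧ n ∈ inwardNormalsAt D x r}

/-- Condition (A): there is `r₀ > 0` with `𝒩_x = 𝒩_{x,r₀} ≠ ∅` for every boundary point `x`. -/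
def ConditionA {d : ℕ} (D : Set (Euc d)) : Prop :=
  ∃ r₀ : ℝ, 0 < r₀ ∧ ∀ x ∈ frontier D,
    inwardNormals D x = inwardNormalsAt D x r₀ ∧ (inwardNormals D x).Nonempty

/-! ### Quantities of paths

A path on `[0,T]` is a function on `ℝ` of which only the values on `[0,T]` are used. The total
variation `‖w‖_{[s,t]}` is Mathlib's `eVariationOn w (Icc s t)`, with values in `[0,∞]`. -/

/-- `‖w‖_{∞,[s,t]} = max_{s ≤ u ≤ v ≤ t} |w_u - w_v|`, with values in `[0,∞]`. -/
noncomputable def pathOscillation {d : ℕ} (w : ℝ → Euc d) (s t : ℝ) : ℝ≥0∞ :=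
  ⨆ u ∈ Icc s t, ⨆ v ∈ Icc u t, edist (w u) (w v)

/-- The path `x` has finite `p`-variation on `[a,b]`: the sums `∑ |x_{t_{k+1}} - x_{t_k}|^p` over
all finite increasing sequences of points of `[a,b]` are bounded. -/
def HasFinitePVariation {n : ℕ} (p : ℝ) (x : ℝ → Euc n) (a b : ℝ) : Prop :=
  ∃ C : ℝ, ∀ (N : ℕ) (t : ℕ → ℝ), Monotone t → (∀ k, t k ∈ Icc a b) →
    ∑ k ∈ Finset.range N, ‖x (t (k + 1)) - x (t k)‖ ^ p ≤ C

/-- The function `t ↦ ‖φ‖_{[0,t]}` on `[0,T]`, extended by constants to the real line. -/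
noncomputable def variationFun {d : ℕ} (φ : ℝ → Euc d) (T t : ℝ) : ℝ :=
  (eVariationOn φ (Icc 0 (min t T))).toReal

theorem variationFun_mono {d : ℕ} {φ : ℝ → Euc d} {T : ℝ}
    (h : BoundedVariationOn φ (Icc 0 T)) : Monotone (variationFun φ T) := by
  intro s t hst
  refine ENNReal.toReal_mono ?_ (eVariationOn.mono φ (Icc_subset_Icc_right (min_le_min_right T hst)))
  exact ne_top_of_le_ne_top h (eVariationOn.mono φ (Icc_subset_Icc_right (min_le_right t T)))

open Classical in
/-- The Lebesgue–Stieltjes measure `d‖φ‖_{[0,s]}` on `[0,T]` of a path `φ` of bounded variation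
(the zero measure if `φ` has infinite variation). -/
noncomputable def variationMeasure {d : ℕ} (φ : ℝ → Euc d) (T : ℝ) : Measure ℝ :=
  if h : BoundedVariationOn φ (Icc 0 T) then (variationFun_mono h).stieltjesFunction.measure else 0

/-- `I = ∫_a^b Φ(r) ⊗ dx_r` as a Young integral: the Riemann–Stieltjes sums
`∑ Φ(τ_k) ⊗ (x_{t_{k+1}} - x_{t_k})`, `τ_k ∈ [t_k, t_{k+1}]`, over the partitions
`a = t_0 ≤ ⋯ ≤ t_N = b` converge to `I` as the mesh tends to `0`. -/
def HasYoungIntegral {d n : ℕ} (Φ : ℝ → Euc d) (x : ℝ → Euc n) (a b : ℝ)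
    (I : Euc d ⊗[ℝ] Euc n) : Prop :=
  ∀ ε : ℝ, 0 < ε → ∃ δ : ℝ, 0 < δ ∧ ∀ (N : ℕ) (t τ : ℕ → ℝ), t 0 = a → t N = b →
    (∀ k < N, t k ≤ τ k ∧ τ k ≤ t (k + 1) ∧ t (k + 1) - t k < δ) →
    ‖(∑ k ∈ Finset.range N, Φ (τ k) ⊗ₜ[ℝ] (x (t (k + 1)) - x (t k))) - I‖ < ε

/-! ### The Skorohod problem -/

/-- `(ξ, φ)` solves the Skorohod problem on `[0,T]` associated with the continuous path `w`:
`ξ_t = w_t + φ(t) ∈ D̄`, where `φ` is a continuous path of bounded variation with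
`φ(t) = ∫_0^t 1_{∂D}(ξ_s) n(s) d‖φ‖_{[0,s]}` and `n(s) ∈ 𝒩_{ξ_s}` whenever `ξ_s ∈ ∂D`.
In particular `φ(0) = 0` and `ξ_0 = w_0`. -/
structure IsSkorohodSolution {d : ℕ} (D : Set (Euc d)) (T : ℝ) (w ξ φ : ℝ → Euc d) : Prop where
  continuousOn_path : ContinuousOn w (Icc 0 T)
  continuousOn_term : ContinuousOn φ (Icc 0 T)
  boundedVariation : BoundedVariationOn φ (Icc 0 T)
  eq_add : ∀ t ∈ Icc 0 T, ξ t = w t + φ t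
  mem_closure : ∀ t ∈ Icc 0 T, ξ t ∈ closure D
  reflection : ∃ n : ℝ → Euc d,
    (∀ s ∈ Icc 0 T, ξ s ∈ frontier D → n s ∈ inwardNormals D (ξ s)) ∧
    IntegrableOn ({s | ξ s ∈ frontier D}.indicator n) (Ioc 0 T) (variationMeasure φ T) ∧
    ∀ t ∈ Icc 0 T,
      φ t = ∫ s in Ioc 0 t, {s | ξ s ∈ frontier D}.indicator n s ∂(variationMeasure φ T)

/-- For every continuous path `w` on `[0,T]` starting in `D̄`, the Skorohod problem has exactly one
solution `(ξ, φ) = (Γ(w), L(w))` on `[0,T]`. -/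
def SkorohodUniquelySolvable {d : ℕ} (D : Set (Euc d)) (T : ℝ) : Prop :=
  ∀ w : ℝ → Euc d, ContinuousOn w (Icc 0 T) → w 0 ∈ closure D →
    (∃ ξ φ : ℝ → Euc d, IsSkorohodSolution D T w ξ φ) ∧
    ∀ ξ φ ξ' φ' : ℝ → Euc d, IsSkorohodSolution D T w ξ φ → IsSkorohodSolution D T w ξ' φ' →
      EqOn ξ ξ' (Icc 0 T) ∧ EqOn φ φ' (Icc 0 T)

/-- Condition (H1): (A) holds, the Skorohod problem is uniquely solvable, and there is `C > 0` with
`‖L(w)‖_{[s,t]} ≤ C ‖w‖_{∞,[s,t]}` for all `0 ≤ s ≤ t ≤ T` and all continuous paths `w`. -/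
def ConditionH1 {d : ℕ} (D : Set (Euc d)) (T : ℝ) : Prop :=
  ConditionA D ∧ SkorohodUniquelySolvable D T ∧
    ∃ C : ℝ≥0, 0 < C ∧ ∀ w ξ φ : ℝ → Euc d, IsSkorohodSolution D T w ξ φ →
      ∀ s t : ℝ, 0 ≤ s → s ≤ t → t ≤ T →
        eVariationOn φ (Icc s t) ≤ (C : ℝ≥0∞) * pathOscillation w s t

/-- Condition (H2): (A) holds, the Skorohod problem is uniquely solvable, and there is `C > 0` with
`‖L(w) - L(w')‖_{∞,[0,t]} ≤ C (‖w - w'‖_{[0,t]} + |w(0) - w'(0)|)` for all `0 ≤ t ≤ T` and all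
continuous paths `w`, `w'` (the right-hand side may be infinite). -/
def ConditionH2 {d : ℕ} (D : Set (Euc d)) (T : ℝ) : Prop :=
  ConditionA D ∧ SkorohodUniquelySolvable D T ∧
    ∃ C : ℝ≥0, 0 < C ∧ ∀ w ξ φ w' ξ' φ' : ℝ → Euc d,
      IsSkorohodSolution D T w ξ φ → IsSkorohodSolution D T w' ξ' φ' →
      ∀ t ∈ Icc 0 T, pathOscillation (fun s => φ s - φ' s) 0 t ≤
        (C : ℝ≥0∞) * (eVariationOn (fun s => w s - w' s) (Icc 0 t) + edist (w 0) (w' 0))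

/-- `(y, Φ)` solves on `[0,T]` the implicit Skorohod equation
`y_t = y₀ + η_t + F(∫_0^t Φ(r) ⊗ dx_r) + Φ(t)`: the integrals exist as Young integrals, and
`(y, Φ)` solves the Skorohod problem associated with `w = y₀ + η + F(∫_0^· Φ(r) ⊗ dx_r)`, that is
`Φ = L(w)`, `y = Γ(w)`. -/
def IsImplicitSkorohodSolution {d n : ℕ} (D : Set (Euc d)) (T : ℝ) (y₀ : Euc d) (η : ℝ → Euc d)
    (F : Euc d ⊗[ℝ] Euc n →ₗ[ℝ] Euc d) (x : ℝ → Euc n) (y Φ : ℝ → Euc d) : Prop :=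
  Φ 0 = 0 ∧ ∃ I : ℝ → Euc d ⊗[ℝ] Euc n,
    (∀ t ∈ Icc 0 T, HasYoungIntegral Φ x 0 t (I t)) ∧
    IsSkorohodSolution D T (fun t => y₀ + η t + F (I t)) y Φ

/-! Both parts solve the fixed point problem for the map sending `Φ` to `L(y₀ + η + F(∫ Φ ⊗ dx))`.
In each part one of the continuous paths `Φ`, `x` has bounded variation, so the integrals are
Riemann–Stieltjes integrals; all that is used of them is the error of a single Riemann term,
recorded in `IsIndefiniteIntegral`.

Under (H2), measure `f - f'` in the sup norm with weight `exp(-2 C CF v(t))`, where `v(t)` is the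
variation of `x` on `[0,t]` and `CF` bounds `F`. Two driving paths differ by a path of variation at
most `CF ∫ |f - f'| dv`, and the weight turns this into a contraction with factor 1/2
(`skorohodTerm_contraction`). Picard iteration then works on all of `[0,T]` at once.

Under (H1), compactness replaces the Lipschitz bound. With the integral replaced by a left Riemann
sum on a grid, the equation is solvable one cell at a time. Summation by parts bounds the increments
of the sum by the variation of `φ` times the oscillation of `x`; on short intervals (H1) absorbs
this term, so the variation of `φ` is bounded uniformly in the grid
(`toReal_eVariationOn_le_pow_of_leftRiemannSum`). (H1) also gives equicontinuity, and Arzelà–Ascoli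
gives a uniform limit, along which the Riemann sums converge to the integral.

The limit is recognised as a reflection term by the stability estimate
`IsSkorohodSolution.norm_sub_sq_le`: the exterior balls of condition (A) give a Gronwall inequality
for `|φ - φ'|²` with respect to `d‖φ‖ + d‖φ'‖`. -/

/-! ### Chaining over short intervals, uniform continuity, additivity of variation. -/

/-- A transitive relation on `[a,b]` that holds for pairs of close points holds for all pairs. -/
theorem forall_le_of_forall_close {R : ℝ → ℝ → Prop} {a b δ : ℝ} (hδ : 0 < δ)
    (htrans : ∀ r s t, a ≤ r → r ≤ s → s ≤ t → t ≤ b → R r s → R s t → R r t)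
    (hloc : ∀ s t, a ≤ s → s ≤ t → t ≤ b → t - s < δ → R s t) :
    ∀ s t, a ≤ s → s ≤ t → t ≤ b → R s t := by
  have key : ∀ n : ℕ, ∀ s t, a ≤ s → s ≤ t → t ≤ b → t - s ≤ n * (δ / 2) → R s t := by
    intro n
    induction n with
    | zero =>
      intro s t hs hst ht h
      exact hloc s t hs hst ht (by simp at h; linarith)
    | succ n ih =>
      intro s t hs hst ht h
      push_cast at h
      have hn : (0 : ℝ) ≤ n * (δ / 2) := by positivity
      -- Peel off a last step of length at most `δ / 2`, hence shorter than `δ`; the maximum with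
      -- `s` keeps the cut point inside `[s,t]`.
      refine htrans s (max s (t - δ / 2)) t hs (le_max_left _ _) (max_le hst (by linarith)) ht
        (ih _ _ hs (le_max_left _ _) ((max_le hst (by linarith)).trans ht) ?_)
        (hloc _ _ (hs.trans (le_max_left _ _)) (max_le hst (by linarith)) ht ?_)
      · rw [sub_le_iff_le_add]
        exact max_le (by linarith) (by linarith)
      · have := le_max_right s (t - δ / 2)
        linarith
  intro s t hs hst ht
  obtain ⟨n, hn⟩ := exists_nat_ge ((t - s) / (δ / 2))
  exact key n s t hs hst ht ((div_le_iff₀ (by linarith)).1 hn)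

/-- Uniform continuity on a compact interval, in terms of the oscillation on short intervals. -/
theorem ContinuousOn.exists_forall_norm_sub_le {E : Type*} [NormedAddCommGroup E] {f : ℝ → E}
    {a b : ℝ} (hf : ContinuousOn f (Icc a b)) {ε : ℝ} (hε : 0 < ε) :
    ∃ δ, 0 < δ ∧ ∀ s ∈ Icc a b, ∀ t ∈ Icc a b, |t - s| < δ → ‖f t - f s‖ ≤ ε := by
  have hu := isCompact_Icc.uniformContinuousOn_of_continuous hf
  obtain ⟨δ, hδ, h⟩ := Metric.uniformContinuousOn_iff.1 hu ε hε
  refine ⟨δ, hδ, fun s hs t ht hst => ?_⟩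
  rw [← dist_eq_norm]
  exact (h t ht s hs (by rwa [Real.dist_eq])).le

theorem BoundedVariationOn.toReal_Icc_add_Icc {E : Type*} [NormedAddCommGroup E] {f : ℝ → E}
    {a b r s t : ℝ} (hf : BoundedVariationOn f (Icc a b)) (hr : a ≤ r) (hrs : r ≤ s) (hst : s ≤ t)
    (ht : t ≤ b) :
    (eVariationOn f (Icc r s)).toReal + (eVariationOn f (Icc s t)).toReal =
      (eVariationOn f (Icc r t)).toReal := by
  rw [← ENNReal.toReal_add (hf.mono (Icc_subset_Icc hr (hst.trans ht)))
    (hf.mono (Icc_subset_Icc (hr.trans hrs) ht))]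
  have := eVariationOn.Icc_add_Icc f (s := univ) hrs hst (mem_univ _)
  simp only [univ_inter] at this
  rw [this]

theorem BoundedVariationOn.norm_sub_le_toReal {E : Type*} [NormedAddCommGroup E] {f : ℝ → E}
    {a b s t : ℝ} (hf : BoundedVariationOn f (Icc a b)) (hs : a ≤ s) (hst : s ≤ t) (ht : t ≤ b) :
    ‖f t - f s‖ ≤ (eVariationOn f (Icc s t)).toReal := by
  rw [← dist_eq_norm]
  exact (hf.mono (Icc_subset_Icc hs ht)).dist_le (right_mem_Icc.2 hst) (left_mem_Icc.2 hst)

/-! ### Riemann–Stieltjes integrals when one of the two paths has bounded variation. -/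

/-- The vector measure with `μ (u, v] = g v - g u`, whose variation is at most that of `g`. -/
theorem exists_vectorMeasure_Ioc {E : Type*} [NormedAddCommGroup E] [CompleteSpace E] {g : ℝ → E}
    (hg : Continuous g) (hv : BoundedVariationOn g univ) :
    ∃ m : VectorMeasure ℝ E, IsFiniteMeasure m.variation ∧
      (∀ u v, u ≤ v → m (Ioc u v) = g v - g u) ∧
      ∀ u v, u ≤ v → m.variation (Ioc u v) ≤ eVariationOn g (Icc u v) := by
  have hR : g.rightLim = g := by
    ext x
    exact hg.continuousAt.continuousWithinAt.rightLim_eq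
  set ν : Measure ℝ := (hv.stieltjesFunctionRightLim 0).measure with hν
  have hfin : IsFiniteMeasure ν := by
    apply StieltjesFunction.isFiniteMeasure_of_forall_abs_le
      (C := (eVariationOn g.rightLim univ).toReal) _ (fun x ↦ ?_)
    exact variationOnFromTo.abs_le_eVariationOn hv.rightLim
  have hIoc : ∀ u v, u ≤ v → ν (Ioc u v) = eVariationOn g (Icc u v) := by
    intro u v huv
    rw [hν, StieltjesFunction.measure_Ioc]
    simp only [BoundedVariationOn.stieltjesFunctionRightLim_apply, hR]
    rw [← variationOnFromTo.add hv.locallyBoundedVariationOn (mem_univ 0) (mem_univ u) (mem_univ v)]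
    simp only [add_sub_cancel_left, variationOnFromTo, huv, ↓reduceIte, univ_inter]
    exact ENNReal.ofReal_toReal (hv.mono (subset_univ _))
  let m := AddContent.onIoc g
  -- Domination by the variation measure `ν` on half-open intervals is what allows the interval
  -- function to be extended to Borel sets.
  have A : ∀ s ∈ {s | ∃ u v, u ≤ v ∧ s = Ioc u v}, ‖m s‖ₑ ≤ ν s := by
    rintro s ⟨u, v, huv, rfl⟩
    rw [AddContent.onIoc_apply huv, hIoc u v huv, ← edist_eq_enorm_sub]
    exact eVariationOn.edist_le _ (right_mem_Icc.2 huv) (left_mem_Icc.2 huv)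
  have B : (inferInstance : MeasurableSpace ℝ) =
      MeasurableSpace.generateFrom {s | ∃ u v, u ≤ v ∧ s = Ioc u v} := by
    rw [BorelSpace.measurable_eq (α := ℝ)]
    convert borel_eq_generateFrom_Ioc_le ℝ using 2
    ext s
    constructor
    · rintro ⟨u, v, h, rfl⟩; exact ⟨u, v, h, rfl⟩
    · rintro ⟨u, v, h, rfl⟩; exact ⟨u, v, h, rfl⟩
  obtain ⟨m', hm', hm'ν⟩ :=
    VectorMeasure.exists_extension_of_isSetSemiring_of_le_measure_of_generateFrom
      IsSetSemiring.Ioc A B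
  have hle : m'.variation ≤ ν := VectorMeasure.variation_le_of_forall_enorm_le fun s _ => hm'ν s
  refine ⟨m', isFiniteMeasure_of_le ν hle, fun u v huv => ?_, fun u v huv => ?_⟩
  · rw [hm' _ ⟨u, v, huv, rfl⟩]
    exact AddContent.onIoc_apply huv
  · exact (hle _).trans (hIoc u v huv).le

section Integral

variable {E F G : Type*} [NormedAddCommGroup E] [NormedSpace ℝ E] [NormedAddCommGroup F]
  [NormedSpace ℝ F] [NormedAddCommGroup G] [NormedSpace ℝ G]

/-- The indefinite integral of a continuous function against a continuous function of bounded
variation, with the error estimate for one term of a Riemann sum. -/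
theorem exists_integral_of_boundedVariationOn_integrator [CompleteSpace F] [CompleteSpace G]
    (B : E →ₗ[ℝ] F →ₗ[ℝ] G) (hB : ∀ x y, ‖B x y‖ ≤ ‖x‖ * ‖y‖)
    {f : ℝ → E} {g : ℝ → F} {a b : ℝ} (hab : a ≤ b) (hf : ContinuousOn f (Icc a b))
    (hg : ContinuousOn g (Icc a b)) (hgv : BoundedVariationOn g (Icc a b)) :
    ∃ I : ℝ → G, I a = 0 ∧ ∀ s τ t ε, a ≤ s → s ≤ τ → τ ≤ t → t ≤ b →
      (∀ u ∈ Icc s t, ∀ v ∈ Icc s t, ‖f u - f v‖ ≤ ε) →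
      ‖I t - I s - B (f τ) (g t - g s)‖ ≤ ε * (eVariationOn g (Icc s t)).toReal := by
  let L : E →L[ℝ] F →L[ℝ] G := B.mkContinuous₂ 1 fun x y => by simpa using hB x y
  have hL : ‖L‖ ≤ 1 := LinearMap.mkContinuous₂_norm_le _ zero_le_one _
  have hLB : ∀ x y, L x y = B x y := fun x y => rfl
  set f' := IccExtend hab ((Icc a b).domRestrict f) with hf'
  set g' := IccExtend hab ((Icc a b).domRestrict g) with hg'
  have hfc : Continuous f' := hf.domRestrict.Icc_extend'
  have hgc : Continuous g' := hg.domRestrict.Icc_extend'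
  have hff : EqOn f' f (Icc a b) := fun x hx => by simp [hf', IccExtend_of_mem hab _ hx, domRestrict]
  have hgg : EqOn g' g (Icc a b) := fun x hx => by simp [hg', IccExtend_of_mem hab _ hx, domRestrict]
  -- The extension by constants is `g` composed with the monotone projection onto `[a,b]`, which
  -- does not increase variation.
  have hgv' : BoundedVariationOn g' univ := by
    have : g' = g ∘ (fun x => (projIcc a b hab x : ℝ)) := rfl
    rw [this]
    refine ne_top_of_le_ne_top hgv (eVariationOn.comp_le_of_monotoneOn g _ ?_ ?_)
    · exact fun x _ y _ hxy => monotone_projIcc hab hxy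
    · exact fun x _ => (projIcc a b hab x).2
  obtain ⟨m, hfin, hm, hmv⟩ := exists_vectorMeasure_Ioc hgc hgv'
  obtain ⟨C, hC⟩ : ∃ C, ∀ x, ‖f' x‖ ≤ C := by
    obtain ⟨C, hC⟩ := isCompact_Icc.exists_bound_of_continuousOn hf
    exact ⟨C, fun x => hC _ (projIcc a b hab x).2⟩
  have hint : m.Integrable f' := by
    refine MeasureTheory.Integrable.mono' (integrable_const C) ?_ (Filter.Eventually.of_forall hC)
    exact hfc.aestronglyMeasurable
  refine ⟨fun t => ∫ᵛ x in Ioc a t, f' x ∂[L; m], by simp, ?_⟩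
  intro s τ t ε has hsτ hτt htb hε
  have hst := hsτ.trans hτt
  have hτ : τ ∈ Icc a b := ⟨has.trans hsτ, hτt.trans htb⟩
  have hsplit : ∫ᵛ x in Ioc a t, f' x ∂[L; m] =
      ∫ᵛ x in Ioc a s, f' x ∂[L; m] + ∫ᵛ x in Ioc s t, f' x ∂[L; m] := by
    rw [← Ioc_union_Ioc_eq_Ioc has hst]
    exact VectorMeasure.setIntegral_union (Ioc_disjoint_Ioc_of_le le_rfl) measurableSet_Ioc
      measurableSet_Ioc hint.integrableOn hint.integrableOn
  have hvar : (m.restrict (Ioc s t)).variation = m.variation.restrict (Ioc s t) :=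
    VectorMeasure.variation_restrict measurableSet_Ioc
  have : IsFiniteMeasure (m.restrict (Ioc s t)).variation := by rw [hvar]; infer_instance
  have hconst : ∫ᵛ _ in Ioc s t, f τ ∂[L; m] = B (f τ) (g t - g s) := by
    rw [← hLB, VectorMeasure.integral_const, VectorMeasure.restrict_apply _ measurableSet_Ioc .univ,
      univ_inter, hm s t hst, hgg ⟨has, hst.trans htb⟩, hgg ⟨has.trans hst, htb⟩]
  have hsub : ∫ᵛ x in Ioc a t, f' x ∂[L; m] - ∫ᵛ x in Ioc a s, f' x ∂[L; m] -
      B (f τ) (g t - g s) = ∫ᵛ x in Ioc s t, (f' x - f τ) ∂[L; m] := by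
    rw [VectorMeasure.integral_fun_sub hint.integrableOn (integrable_const _), hconst, hsplit]
    abel
  have hε0 : 0 ≤ ε := (norm_nonneg _).trans (hε τ ⟨hsτ, hτt⟩ τ ⟨hsτ, hτt⟩)
  have hreal : (m.restrict (Ioc s t)).variation.real univ ≤ (eVariationOn g (Icc s t)).toReal := by
    have hst' : Icc s t ⊆ Icc a b := Icc_subset_Icc has htb
    rw [hvar, measureReal_restrict_apply_univ, Measure.real,
      ← eVariationOn.congr (hgg.mono hst')]
    exact ENNReal.toReal_mono (hgv'.mono (subset_univ _)) (hmv s t hst)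
  simp only
  rw [hsub]
  calc _ ≤ ε * ‖L‖ * (m.restrict (Ioc s t)).variation.real univ := by
        refine VectorMeasure.norm_integral_le_of_norm_le_const ?_
        rw [hvar]
        refine (ae_restrict_iff' measurableSet_Ioc).2 (Filter.Eventually.of_forall fun x hx => ?_)
        rw [hff ⟨has.trans hx.1.le, hx.2.trans htb⟩]
        exact hε x ⟨hx.1.le, hx.2⟩ τ ⟨hsτ, hτt⟩
    _ ≤ ε * 1 * (eVariationOn g (Icc s t)).toReal := by gcongr
    _ = _ := by rw [mul_one]

/-- The indefinite integral of a continuous function of bounded variation against a continuous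
function, with the error estimate for one term of a Riemann sum. -/
theorem exists_integral_of_boundedVariationOn_integrand [CompleteSpace E] [CompleteSpace G]
    (B : E →ₗ[ℝ] F →ₗ[ℝ] G) (hB : ∀ x y, ‖B x y‖ ≤ ‖x‖ * ‖y‖)
    {f : ℝ → E} {g : ℝ → F} {a b : ℝ} (hab : a ≤ b) (hf : ContinuousOn f (Icc a b))
    (hg : ContinuousOn g (Icc a b)) (hfv : BoundedVariationOn f (Icc a b)) :
    ∃ I : ℝ → G, I a = 0 ∧ ∀ s τ t ε, a ≤ s → s ≤ τ → τ ≤ t → t ≤ b →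
      (∀ u ∈ Icc s t, ∀ v ∈ Icc s t, ‖g u - g v‖ ≤ ε) →
      ‖I t - I s - B (f τ) (g t - g s)‖ ≤ ε * (eVariationOn f (Icc s t)).toReal := by
  obtain ⟨J, hJ0, hJ⟩ := exists_integral_of_boundedVariationOn_integrator B.flip
    (fun y x => by simpa [mul_comm] using hB x y) hab hg hf hfv
  -- Integration by parts defines the integral; `J` is `∫ g df`.
  refine ⟨fun t => B (f t) (g t) - B (f a) (g a) - J t, by simp [hJ0], ?_⟩
  intro s τ t ε has hsτ hτt htb hε
  have h1 := hJ s s τ ε has le_rfl hsτ (hτt.trans htb) fun u hu v hv =>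
    hε u ⟨hu.1, hu.2.trans hτt⟩ v ⟨hv.1, hv.2.trans hτt⟩
  have h2 := hJ τ t t ε (has.trans hsτ) hτt le_rfl htb fun u hu v hv =>
    hε u ⟨hsτ.trans hu.1, hu.2⟩ v ⟨hsτ.trans hv.1, hv.2⟩
  simp only [LinearMap.flip_apply] at h1 h2
  -- Cutting the cell at the tag `τ` writes its error as two errors for `J`, tagged at the endpoints
  -- `s` and `t`; their variations add up.
  have e : B (f t) (g t) - B (f a) (g a) - J t - (B (f s) (g s) - B (f a) (g a) - J s) -
      B (f τ) (g t - g s) = -((J τ - J s - B (f τ - f s) (g s)) + (J t - J τ - B (f t - f τ) (g t)))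
      := by
    simp only [map_sub, LinearMap.sub_apply]
    abel
  simp only
  rw [e, norm_neg, ← hfv.toReal_Icc_add_Icc has hsτ hτt htb, mul_add]
  exact (norm_add_le _ _).trans (add_le_add h1 h2)

end Integral

/-- `I` vanishes at `0` and its increment over `[s,t] ⊆ [0,T]` differs from the Riemann sum term
`Φ τ ⊗ (x t - x s)`, `s ≤ τ ≤ t`, by at most the oscillation of `h` times the variation of `v`. -/
structure IsIndefiniteIntegral {E E' : Type*} [NormedAddCommGroup E] [NormedAddCommGroup E']
    {d n : ℕ} (h : ℝ → E) (v : ℝ → E') (T : ℝ) (Φ : ℝ → Euc d) (x : ℝ → Euc n)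
    (I : ℝ → Euc d ⊗[ℝ] Euc n) : Prop where
  zero : I 0 = 0
  cell : ∀ s τ t ε, 0 ≤ s → s ≤ τ → τ ≤ t → t ≤ T →
    (∀ u ∈ Icc s t, ∀ v ∈ Icc s t, ‖h u - h v‖ ≤ ε) →
    ‖I t - I s - Φ τ ⊗ₜ[ℝ] (x t - x s)‖ ≤ ε * (eVariationOn v (Icc s t)).toReal

/-- The two admissible choices of the pair `(h, v)` are `(Φ, x)`, used under (H2), and `(x, Φ)`,
used under (H1). Keeping `h` and `v` abstract lets the facts on Riemann sums serve both. -/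
theorem exists_isIndefiniteIntegral_of_integrator {d n : ℕ} {T : ℝ} (hT : 0 ≤ T)
    {Φ : ℝ → Euc d} {x : ℝ → Euc n} (hΦ : ContinuousOn Φ (Icc 0 T)) (hx : ContinuousOn x (Icc 0 T))
    (hv : BoundedVariationOn x (Icc 0 T)) : ∃ I, IsIndefiniteIntegral Φ x T Φ x I := by
  have : CompleteSpace (Euc d ⊗[ℝ] Euc n) := FiniteDimensional.complete ℝ _
  obtain ⟨I, h0, hI⟩ := exists_integral_of_boundedVariationOn_integrator
    (TensorProduct.mk ℝ (Euc d) (Euc n)) (fun a b => (TensorProduct.norm_tmul a b).le) hT hΦ hx hv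
  exact ⟨I, h0, hI⟩

theorem exists_isIndefiniteIntegral_of_integrand {d n : ℕ} {T : ℝ} (hT : 0 ≤ T)
    {Φ : ℝ → Euc d} {x : ℝ → Euc n} (hΦ : ContinuousOn Φ (Icc 0 T)) (hx : ContinuousOn x (Icc 0 T))
    (hv : BoundedVariationOn Φ (Icc 0 T)) : ∃ I, IsIndefiniteIntegral x Φ T Φ x I := by
  have : CompleteSpace (Euc d ⊗[ℝ] Euc n) := FiniteDimensional.complete ℝ _
  obtain ⟨I, h0, hI⟩ := exists_integral_of_boundedVariationOn_integrand
    (TensorProduct.mk ℝ (Euc d) (Euc n)) (fun a b => (TensorProduct.norm_tmul a b).le) hT hΦ hx hv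
  exact ⟨I, h0, hI⟩

theorem le_of_forall_lt_le_succ {t : ℕ → ℝ} {N : ℕ} (h : ∀ k < N, t k ≤ t (k + 1)) :
    ∀ j k, j ≤ k → k ≤ N → t j ≤ t k := by
  intro j k hjk
  induction k, hjk using Nat.le_induction with
  | base => exact fun _ => le_rfl
  | succ k hjk ih => exact fun hk => (ih (by omega)).trans (h k (by omega))

namespace IsIndefiniteIntegral

variable {E E' : Type*} [NormedAddCommGroup E] [NormedAddCommGroup E']
    {d n : ℕ} {h : ℝ → E} {v : ℝ → E'} {T : ℝ} {Φ : ℝ → Euc d} {x : ℝ → Euc n}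
    {I : ℝ → Euc d ⊗[ℝ] Euc n}

theorem norm_riemannSum_sub_le (hI : IsIndefiniteIntegral h v T Φ x I)
    (hv : BoundedVariationOn v (Icc 0 T)) {ε : ℝ} {t τ : ℕ → ℝ} (h0 : 0 ≤ t 0) (N : ℕ)
    (hN : t N ≤ T) (hτ : ∀ k < N, t k ≤ τ k ∧ τ k ≤ t (k + 1))
    (hε : ∀ k < N, ∀ u ∈ Icc (t k) (t (k + 1)), ∀ v ∈ Icc (t k) (t (k + 1)), ‖h u - h v‖ ≤ ε) :
    ‖(∑ k ∈ Finset.range N, Φ (τ k) ⊗ₜ[ℝ] (x (t (k + 1)) - x (t k))) - (I (t N) - I (t 0))‖ ≤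
      ε * (eVariationOn v (Icc (t 0) (t N))).toReal := by
  induction N with
  | zero => simp [eVariationOn.subsingleton]
  | succ N ih =>
    have hN' := hτ N (Nat.lt_succ_self N)
    have hmono : t 0 ≤ t N := le_of_forall_lt_le_succ
      (fun k hk => (hτ k (by omega)).1.trans (hτ k (by omega)).2) 0 N (Nat.zero_le _) le_rfl
    have hNs : t N ≤ t (N + 1) := hN'.1.trans hN'.2
    have h1 := ih (hNs.trans hN) (fun k hk => hτ k (by omega)) (fun k hk => hε k (by omega))
    have h2 := hI.cell (t N) (τ N) (t (N + 1)) ε (h0.trans hmono) hN'.1 hN'.2 hN (hε N (by omega))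
    rw [Finset.sum_range_succ, ← hv.toReal_Icc_add_Icc h0 hmono hNs hN, mul_add]
    refine le_trans (le_of_eq ?_) ((norm_sub_le _ _).trans (add_le_add h1 h2))
    congr 1
    abel

/-- Cell errors add up to at most the oscillation of `h` over one cell times the total variation of
`v`, and the former vanishes with the mesh. -/
theorem hasYoungIntegral (hI : IsIndefiniteIntegral h v T Φ x I)
    (hv : BoundedVariationOn v (Icc 0 T)) (hh : ContinuousOn h (Icc 0 T)) {r : ℝ}
    (hr : r ∈ Icc 0 T) : HasYoungIntegral Φ x 0 r (I r) := by
  intro ε hε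
  set V := (eVariationOn v (Icc 0 T)).toReal with hV
  have hV0 : 0 ≤ V := ENNReal.toReal_nonneg
  obtain ⟨δ, hδ, H⟩ := hh.exists_forall_norm_sub_le (ε := ε / (V + 1)) (by positivity)
  refine ⟨δ, hδ, fun N t τ ht0 htN ht => ?_⟩
  have hm := le_of_forall_lt_le_succ (fun k (hk : k < N) => (ht k hk).1.trans (ht k hk).2.1)
  have key := hI.norm_riemannSum_sub_le hv (t := t) (τ := τ) (ε := ε / (V + 1)) ht0.ge N
    (htN.trans_le hr.2) (fun k hk => ⟨(ht k hk).1, (ht k hk).2.1⟩) (by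
      intro k hk u hu w hw
      have h0k : 0 ≤ t k := ht0 ▸ hm 0 k (Nat.zero_le _) hk.le
      have hkN : t (k + 1) ≤ T := (hm (k + 1) N hk le_rfl).trans (htN.trans_le hr.2)
      refine H w ⟨h0k.trans hw.1, hw.2.trans hkN⟩ u ⟨h0k.trans hu.1, hu.2.trans hkN⟩ ?_
      have := (ht k hk).2.2
      rw [abs_lt]
      constructor <;> linarith [hu.1, hu.2, hw.1, hw.2])
  rw [htN, ht0, hI.zero, sub_zero] at key
  refine key.trans_lt ?_
  have hle : (eVariationOn v (Icc 0 r)).toReal ≤ V :=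
    ENNReal.toReal_mono hv (eVariationOn.mono v (Icc_subset_Icc_right hr.2))
  calc _ ≤ ε / (V + 1) * V := by gcongr
    _ < ε := by
      rw [div_mul_eq_mul_div, div_lt_iff₀ (by positivity)]
      nlinarith

theorem continuousOn (hI : IsIndefiniteIntegral h v T Φ x I)
    (hv : BoundedVariationOn v (Icc 0 T)) (hh : ContinuousOn h (Icc 0 T))
    (hΦ : ContinuousOn Φ (Icc 0 T)) (hx : ContinuousOn x (Icc 0 T)) :
    ContinuousOn I (Icc 0 T) := by
  set V := (eVariationOn v (Icc 0 T)).toReal with hV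
  have hV0 : 0 ≤ V := ENNReal.toReal_nonneg
  obtain ⟨C, hC⟩ := isCompact_Icc.exists_bound_of_continuousOn hΦ
  rw [Metric.continuousOn_iff]
  intro r hr ε hε
  have hC0 : 0 ≤ C := (norm_nonneg _).trans (hC r hr)
  obtain ⟨δ₁, hδ₁, H₁⟩ := hh.exists_forall_norm_sub_le (ε := ε / (2 * (V + 1))) (by positivity)
  obtain ⟨δ₂, hδ₂, H₂⟩ := hx.exists_forall_norm_sub_le (ε := ε / (2 * (C + 1))) (by positivity)
  have key : ∀ s ∈ Icc 0 T, ∀ t ∈ Icc 0 T, s ≤ t → |t - s| < min δ₁ δ₂ → ‖I t - I s‖ < ε := by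
    intro s hs t ht hst hlt
    have h1 := hI.cell s s t (ε / (2 * (V + 1))) hs.1 le_rfl hst ht.2 (by
      intro u hu w hw
      refine H₁ w ⟨hs.1.trans hw.1, hw.2.trans ht.2⟩ u ⟨hs.1.trans hu.1, hu.2.trans ht.2⟩ ?_
      refine lt_of_le_of_lt ?_ (hlt.trans_le (min_le_left _ _))
      rw [abs_of_nonneg (sub_nonneg.2 hst), abs_le]
      constructor <;> linarith [hu.1, hu.2, hw.1, hw.2])
    have h2 : ‖Φ s ⊗ₜ[ℝ] (x t - x s)‖ ≤ C * (ε / (2 * (C + 1))) := by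
      rw [TensorProduct.norm_tmul]
      gcongr
      · exact hC s hs
      · exact H₂ s hs t ht (hlt.trans_le (min_le_right _ _))
    have hle : (eVariationOn v (Icc s t)).toReal ≤ V :=
      ENNReal.toReal_mono hv (eVariationOn.mono v (Icc_subset_Icc hs.1 ht.2))
    have h3 : C * (ε / (2 * (C + 1))) < ε / 2 := by
      rw [mul_div_assoc', div_lt_div_iff₀ (by positivity) (by positivity)]
      nlinarith
    have h4 : ε / (2 * (V + 1)) * (eVariationOn v (Icc s t)).toReal ≤ ε / 2 := by
      calc _ ≤ ε / (2 * (V + 1)) * V := by gcongr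
        _ ≤ _ := by
          rw [div_mul_eq_mul_div, div_le_div_iff₀ (by positivity) (by positivity)]
          nlinarith
    have := norm_add_le (I t - I s - Φ s ⊗ₜ[ℝ] (x t - x s)) (Φ s ⊗ₜ[ℝ] (x t - x s))
    rw [sub_add_cancel] at this
    linarith
  refine ⟨min δ₁ δ₂, lt_min hδ₁ hδ₂, fun s hs hsr => ?_⟩
  rw [Real.dist_eq] at hsr
  rcases le_total s r with hle | hle
  · rw [dist_comm, dist_eq_norm]
    exact key s hs r hr hle (by rwa [abs_sub_comm])
  · rw [dist_eq_norm]
    exact key r hr s hs hle hsr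

end IsIndefiniteIntegral

theorem HasYoungIntegral.unique {d n : ℕ} {Φ : ℝ → Euc d} {x : ℝ → Euc n} {a b : ℝ}
    {I J : Euc d ⊗[ℝ] Euc n} (hab : a ≤ b) (hI : HasYoungIntegral Φ x a b I)
    (hJ : HasYoungIntegral Φ x a b J) : I = J := by
  refine eq_of_norm_sub_le_zero (le_of_forall_pos_le_add fun ε hε => ?_)
  obtain ⟨δ₁, hδ₁, h₁⟩ := hI (ε / 2) (by positivity)
  obtain ⟨δ₂, hδ₂, h₂⟩ := hJ (ε / 2) (by positivity)
  obtain ⟨N, hN⟩ := exists_nat_gt ((b - a) / min δ₁ δ₂)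
  have hδ : 0 < min δ₁ δ₂ := lt_min hδ₁ hδ₂
  have hN0 : (0 : ℝ) < N := lt_of_le_of_lt (div_nonneg (sub_nonneg.2 hab) hδ.le) hN
  have hstep : (b - a) / N < min δ₁ δ₂ := by
    rw [div_lt_iff₀ hδ] at hN
    rw [div_lt_iff₀ hN0]
    linarith
  have hstep0 : 0 ≤ (b - a) / N := div_nonneg (sub_nonneg.2 hab) hN0.le
  let t : ℕ → ℝ := fun k => a + k * ((b - a) / N)
  have ht : ∀ k, t (k + 1) - t k = (b - a) / N := fun k => by simp only [t]; push_cast; ring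
  have ht0 : t 0 = a := by simp [t]
  have htN : t N = b := by simp only [t]; field_simp; ring
  have h1 := h₁ N t t ht0 htN fun k _ =>
    ⟨le_rfl, by linarith [ht k], (ht k).trans_lt (hstep.trans_le (min_le_left _ _))⟩
  have h2 := h₂ N t t ht0 htN fun k _ =>
    ⟨le_rfl, by linarith [ht k], (ht k).trans_lt (hstep.trans_le (min_le_right _ _))⟩
  rw [← norm_neg, neg_sub] at h1
  have := norm_add_le_of_le h1.le h2.le
  rw [sub_add_sub_cancel] at this
  linarith

theorem HasYoungIntegral.congr {d n : ℕ} {Φ Φ' : ℝ → Euc d} {x : ℝ → Euc n} {a b : ℝ}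
    {I : Euc d ⊗[ℝ] Euc n} (hI : HasYoungIntegral Φ x a b I) (h : EqOn Φ Φ' (Icc a b)) :
    HasYoungIntegral Φ' x a b I := by
  intro ε hε
  obtain ⟨δ, hδ, H⟩ := hI ε hε
  refine ⟨δ, hδ, fun N t τ ht0 htN ht => ?_⟩
  convert H N t τ ht0 htN ht using 3
  refine Finset.sum_congr rfl fun k hk => ?_
  have hk := Finset.mem_range.1 hk
  have hm := le_of_forall_lt_le_succ (fun k (hk : k < N) => (ht k hk).1.trans (ht k hk).2.1)
  rw [h ⟨(ht0 ▸ hm 0 k (Nat.zero_le _) hk.le).trans (ht k hk).1,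
    (ht k hk).2.1.trans (htN ▸ hm (k + 1) N hk le_rfl)⟩]

/-! ### Exterior balls and stability of the Skorohod problem. -/

/-- An open ball missing `D` also misses its closure, so `|y - (x - r n)| ≥ r`; expand the square.
-/
theorem inner_sub_le_of_mem_inwardNormalsAt {d : ℕ} {D : Set (Euc d)} {x y n : Euc d} {r : ℝ}
    (hr : 0 < r) (hn : n ∈ inwardNormalsAt D x r) (hy : y ∈ closure D) :
    inner ℝ (x - y) n ≤ ‖x - y‖ ^ 2 / (2 * r) := by
  have hsub : closure D ⊆ {y | r ≤ ‖y - (x - r • n)‖} := by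
    refine closure_minimal (fun z hz => ?_) (isClosed_le continuous_const (by fun_prop))
    by_contra hlt
    have : z ∈ Metric.ball (x - r • n) r ∩ D :=
      ⟨by simpa [dist_eq_norm] using hlt, hz⟩
    rw [hn.2] at this
    exact this
  have h1 : r ≤ ‖y - (x - r • n)‖ := hsub hy
  have h2 : r ^ 2 ≤ ‖r • n - (x - y)‖ ^ 2 := by
    have : y - (x - r • n) = r • n - (x - y) := by abel
    rw [this] at h1
    gcongr
  rw [norm_sub_sq_real, norm_smul, hn.1, inner_smul_left, real_inner_comm] at h2
  simp only [Real.norm_eq_abs, abs_of_pos hr, mul_one, conj_trivial] at h2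
  rw [le_div_iff₀ (by positivity)]
  linarith

section VariationMeasure

variable {d : ℕ} {φ : ℝ → Euc d} {T : ℝ}

theorem variationFun_le (h : BoundedVariationOn φ (Icc 0 T)) (t : ℝ) :
    variationFun φ T t ≤ (eVariationOn φ (Icc 0 T)).toReal :=
  ENNReal.toReal_mono h (eVariationOn.mono φ (Icc_subset_Icc_right (min_le_right t T)))

/-- A bound by the total variation is all that stability needs, so the right limits in the Stieltjes
function can be estimated crudely, without continuity of `variationFun`. -/
theorem variationMeasure_Ioc_le (h : BoundedVariationOn φ (Icc 0 T)) (s t : ℝ) :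
    variationMeasure φ T (Ioc s t) ≤ eVariationOn φ (Icc 0 T) := by
  rw [variationMeasure, dif_pos h, StieltjesFunction.measure_Ioc, Monotone.stieltjesFunction_eq,
    Monotone.stieltjesFunction_eq]
  refine ENNReal.ofReal_le_of_le_toReal ?_
  have h1 := ((variationFun_mono h).rightLim_le (lt_add_one t)).trans (variationFun_le h _)
  have h2 : 0 ≤ variationFun φ T s := ENNReal.toReal_nonneg
  have h3 := (variationFun_mono h).le_rightLim (le_refl s)
  linarith

theorem variationMeasure_Ioc_ne_top (h : BoundedVariationOn φ (Icc 0 T)) (s t : ℝ) :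
    variationMeasure φ T (Ioc s t) ≠ ∞ :=
  ne_top_of_le_ne_top h (variationMeasure_Ioc_le h s t)

theorem variationMeasure_real_Ioc_add (h : BoundedVariationOn φ (Icc 0 T)) {r s t : ℝ}
    (hrs : r ≤ s) (hst : s ≤ t) :
    (variationMeasure φ T).real (Ioc r t) =
      (variationMeasure φ T).real (Ioc r s) + (variationMeasure φ T).real (Ioc s t) := by
  rw [← Ioc_union_Ioc_eq_Ioc hrs hst]
  exact measureReal_union (Ioc_disjoint_Ioc_of_le le_rfl) measurableSet_Ioc
    (variationMeasure_Ioc_ne_top h _ _) (variationMeasure_Ioc_ne_top h _ _)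

end VariationMeasure

namespace IsSkorohodSolution

variable {d : ℕ} {D : Set (Euc d)} {T : ℝ} {w ξ φ w' ξ' φ' : ℝ → Euc d}

theorem term_zero (h : IsSkorohodSolution D T w ξ φ) (hT : 0 ≤ T) : φ 0 = 0 := by
  obtain ⟨n, -, -, hn⟩ := h.reflection
  simpa using hn 0 ⟨le_rfl, hT⟩

/-- If every inward normal along the path satisfies `⟨z, n⟩ ≤ b` on `(s,t]`, then the increment of
the reflection term satisfies `⟨z, φ t - φ s⟩ ≤ b d‖φ‖((s,t])`. -/
theorem inner_increment_le (h : IsSkorohodSolution D T w ξ φ) {s t b : ℝ} (hs : 0 ≤ s)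
    (hst : s ≤ t) (ht : t ≤ T) (hb : 0 ≤ b) (z : Euc d)
    (hz : ∀ u ∈ Ioc s t, ξ u ∈ frontier D → ∀ n ∈ inwardNormals D (ξ u), inner ℝ z n ≤ b) :
    inner ℝ z (φ t - φ s) ≤ b * (variationMeasure φ T).real (Ioc s t) := by
  obtain ⟨n, hn, hint, hφ⟩ := h.reflection
  set ν := {s | ξ s ∈ frontier D}.indicator n with hν
  have hints : ∀ u v, 0 ≤ u → v ≤ T → IntegrableOn ν (Ioc u v) (variationMeasure φ T) :=
    fun u v hu hv => hint.mono_set (Ioc_subset_Ioc hu hv)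
  have hinc : φ t - φ s = ∫ u in Ioc s t, ν u ∂(variationMeasure φ T) := by
    rw [hφ t ⟨hs.trans hst, ht⟩, hφ s ⟨hs, hst.trans ht⟩, ← Ioc_union_Ioc_eq_Ioc hs hst,
      setIntegral_union (Ioc_disjoint_Ioc_of_le le_rfl) measurableSet_Ioc
        (hints 0 s le_rfl (hst.trans ht)) (hints s t hs ht), add_sub_cancel_left]
  rw [hinc, ← integral_inner (hints s t hs ht)]
  calc _ ≤ ∫ _ in Ioc s t, b ∂(variationMeasure φ T) := by
        refine setIntegral_mono_on ((hints s t hs ht).const_inner z)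
          (integrableOn_const (variationMeasure_Ioc_ne_top h.boundedVariation _ _))
          measurableSet_Ioc fun u hu => ?_
        by_cases hu' : ξ u ∈ frontier D
        · rw [hν, indicator_of_mem (by exact hu')]
          exact hz u hu hu' _ (hn u ⟨hs.trans hu.1.le, hu.2.trans ht⟩ hu')
        · rw [hν, indicator_of_notMem (by exact hu'), inner_zero_right]
          exact hb
    _ = _ := by rw [setIntegral_const, smul_eq_mul, mul_comm]

/-- One half of the estimate of `|z t|² - |z s|² = ⟨z t + z s, z t - z s⟩` for `z = φ - φ'`;
exchanging the two solutions gives the other half. On a short interval `z t + z s` is nearly `2 (ξ u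
- ξ' u)`, whose product with a normal at `ξ u` is controlled by the exterior ball. -/
theorem inner_increment_le_of_close (h : IsSkorohodSolution D T w ξ φ)
    (h' : IsSkorohodSolution D T w' ξ' φ') {r : ℝ} (hr : 0 < r)
    (hA : ∀ x ∈ frontier D, inwardNormals D x = inwardNormalsAt D x r) {s t ε δ : ℝ} (hs : 0 ≤ s)
    (hst : s ≤ t) (ht : t ≤ T) (hε : 0 ≤ ε) (hδ : 0 ≤ δ) (hw : ∀ u ∈ Icc s t, ‖w u - w' u‖ ≤ ε)
    (hosc : ∀ u ∈ Icc s t, ∀ v ∈ Icc s t, ‖(φ u - φ' u) - (φ v - φ' v)‖ ≤ δ)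
    (hosc2 : ∀ u ∈ Icc s t, ‖φ u - φ' u‖ ^ 2 ≤ ‖φ s - φ' s‖ ^ 2 + δ) :
    inner ℝ ((φ t - φ' t) + (φ s - φ' s)) (φ t - φ s) ≤
      (2 / r * ‖φ s - φ' s‖ ^ 2 + (2 / r * (ε ^ 2 + r * ε + (1 + r) * δ))) *
        (variationMeasure φ T).real (Ioc s t) := by
  refine h.inner_increment_le hs hst ht (by positivity) _ fun u hu hu' n hn => ?_
  have hu0 : u ∈ Icc 0 T := ⟨hs.trans hu.1.le, hu.2.trans ht⟩
  have hust : u ∈ Icc s t := ⟨hu.1.le, hu.2⟩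
  rw [hA _ hu'] at hn
  have h1 := inner_sub_le_of_mem_inwardNormalsAt hr hn (h'.mem_closure u hu0)
  have hin : ∀ a : Euc d, inner ℝ a n ≤ ‖a‖ := fun a => by
    simpa [hn.1] using real_inner_le_norm a n
  set z : ℝ → Euc d := fun u => φ u - φ' u with hz
  have hξ : ξ u - ξ' u = (w u - w' u) + z u := by
    rw [h.eq_add u hu0, h'.eq_add u hu0]; simp only [hz]; abel
  have h2 : ‖ξ u - ξ' u‖ ^ 2 ≤ 2 * ε ^ 2 + 2 * (‖z s‖ ^ 2 + δ) := by
    have e1 : ‖ξ u - ξ' u‖ ≤ ε + ‖z u‖ := by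
      rw [hξ]
      exact (norm_add_le _ _).trans (add_le_add_left (hw u hust) _)
    have e2 : ‖z u‖ ^ 2 ≤ ‖z s‖ ^ 2 + δ := hosc2 u hust
    have e3 : ‖ξ u - ξ' u‖ ^ 2 ≤ (ε + ‖z u‖) ^ 2 := by gcongr
    nlinarith [sq_nonneg (ε - ‖z u‖)]
  have hdec : z t + z s = 2 • (ξ u - ξ' u) + 2 • (w' u - w u) + (z t - z u) + (z s - z u) := by
    rw [hξ, two_smul, two_smul]; abel
  have e : inner ℝ (z t + z s) n = 2 * inner ℝ (ξ u - ξ' u) n + 2 * inner ℝ (w' u - w u) n +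
      inner ℝ (z t - z u) n + inner ℝ (z s - z u) n := by
    rw [hdec, two_smul, two_smul]
    simp only [inner_add_left]
    ring
  change inner ℝ (z t + z s) n ≤ 2 / r * ‖z s‖ ^ 2 + (2 / r * (ε ^ 2 + r * ε + (1 + r) * δ))
  rw [e]
  have h3 := (hin (w' u - w u)).trans ((norm_sub_rev _ _).le.trans (hw u hust))
  have h4 := (hin (z t - z u)).trans (hosc t (right_mem_Icc.2 hst) u hust)
  have h5 := (hin (z s - z u)).trans (hosc s (left_mem_Icc.2 hst) u hust)
  have h6 : ‖ξ u - ξ' u‖ ^ 2 / (2 * r) ≤ (2 * ε ^ 2 + 2 * (‖z s‖ ^ 2 + δ)) / (2 * r) := by gcongr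
  have h7 : 2 / r * ‖z s‖ ^ 2 + (2 / r * (ε ^ 2 + r * ε + (1 + r) * δ)) =
      2 * ((2 * ε ^ 2 + 2 * (‖z s‖ ^ 2 + δ)) / (2 * r)) + 2 * ε + δ + δ := by
    field_simp
    ring
  rw [h7]
  linarith

/-- Stability of the Skorohod problem: if `w` and `w'` are uniformly close on `[0,t₀]`, then so are
the reflection terms, with a modulus depending on their total variations. -/
theorem norm_sub_sq_le (h : IsSkorohodSolution D T w ξ φ)
    (h' : IsSkorohodSolution D T w' ξ' φ') {r : ℝ} (hr : 0 < r)
    (hA : ∀ x ∈ frontier D, inwardNormals D x = inwardNormalsAt D x r) {t₀ ε : ℝ} (ht₀ : t₀ ≤ T)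
    (hε : 0 ≤ ε) (hw : ∀ s ∈ Icc 0 t₀, ‖w s - w' s‖ ≤ ε) :
    ∀ t ∈ Icc 0 t₀, ‖φ t - φ' t‖ ^ 2 ≤ (ε ^ 2 + r * ε) * Real.exp (2 / r *
      ((eVariationOn φ (Icc 0 T)).toReal + (eVariationOn φ' (Icc 0 T)).toReal)) := by
  intro t ht
  set V := (eVariationOn φ (Icc 0 T)).toReal + (eVariationOn φ' (Icc 0 T)).toReal with hV
  set z : ℝ → Euc d := fun u => φ u - φ' u with hz
  set c := 2 / r with hc
  have hc0 : 0 < c := by positivity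
  have hzc : ContinuousOn z (Icc 0 T) := h.continuousOn_term.sub h'.continuousOn_term
  have hz2c : ContinuousOn (fun u => ‖z u‖ ^ 2) (Icc 0 T) := hzc.norm.pow 2
  set μ := (variationMeasure φ T)
  set μ' := (variationMeasure φ' T)
  set A : ℝ → ℝ := fun t => μ.real (Ioc 0 t) + μ'.real (Ioc 0 t) with hAdef
  have hAV : A t ≤ V := by
    refine add_le_add ?_ ?_
    · exact ENNReal.toReal_mono h.boundedVariation (variationMeasure_Ioc_le h.boundedVariation _ _)
    · exact ENNReal.toReal_mono h'.boundedVariation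
        (variationMeasure_Ioc_le h'.boundedVariation _ _)
  refine le_of_forall_pos_le_add fun e he => ?_
  -- Chosen so that the discretisation error `(1 + r) δ exp(c V)` equals `e`.
  set δ := e / ((1 + r) * Real.exp (c * V)) with hδ
  have hδ0 : 0 < δ := by positivity
  obtain ⟨η₁, hη₁, H₁⟩ := hzc.exists_forall_norm_sub_le hδ0
  obtain ⟨η₂, hη₂, H₂⟩ := hz2c.exists_forall_norm_sub_le hδ0
  set κ := ε ^ 2 + r * ε + (1 + r) * δ with hκ
  have hκ0 : 0 ≤ κ := by positivity
  -- Discrete Gronwall: if the interval `(s,t]` is short and has mass `a` for the two variation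
  -- measures, then `‖z t‖² + κ ≤ (‖z s‖² + κ)(1 + c a)`. Hence the weighted quantity below
  -- decreases along short intervals, and so along all.
  have key := forall_le_of_forall_close (a := 0) (b := t₀) (lt_min hη₁ hη₂)
    (R := fun s t => (‖z t‖ ^ 2 + κ) * Real.exp (-(c * A t)) ≤
      (‖z s‖ ^ 2 + κ) * Real.exp (-(c * A s)))
    (fun _ _ _ _ _ _ _ h1 h2 => h2.trans h1) (by
      intro s t hs hst ht hlt
      have htT : t ≤ T := ht.trans ht₀
      have hmem : ∀ u ∈ Icc s t, u ∈ Icc 0 T := fun u hu => ⟨hs.trans hu.1, hu.2.trans htT⟩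
      have habs : ∀ u ∈ Icc s t, ∀ v ∈ Icc s t, |u - v| < min η₁ η₂ := fun u hu v hv => by
        rw [abs_lt]; constructor <;> linarith [hu.1, hu.2, hv.1, hv.2]
      have hw1 : ∀ u ∈ Icc s t, ‖w u - w' u‖ ≤ ε := fun u hu =>
        hw u ⟨hs.trans hu.1, hu.2.trans ht⟩
      have ho : ∀ u ∈ Icc s t, ∀ v ∈ Icc s t, ‖z u - z v‖ ≤ δ := fun u hu v hv =>
        H₁ v (hmem v hv) u (hmem u hu) ((habs u hu v hv).trans_le (min_le_left _ _))
      have ho2 : ∀ u ∈ Icc s t, ‖z u‖ ^ 2 ≤ ‖z s‖ ^ 2 + δ := fun u hu => by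
        have h1 := H₂ s (hmem s (left_mem_Icc.2 hst)) u (hmem u hu)
          ((habs u hu s (left_mem_Icc.2 hst)).trans_le (min_le_right _ _))
        linarith [le_abs_self (‖z u‖ ^ 2 - ‖z s‖ ^ 2), Real.norm_eq_abs (‖z u‖ ^ 2 - ‖z s‖ ^ 2)]
      have i1 := h.inner_increment_le_of_close h' hr hA hs hst htT hε hδ0.le hw1 ho ho2
      have i2 := h'.inner_increment_le_of_close h hr hA hs hst htT hε hδ0.le
        (fun u hu => by rw [norm_sub_rev]; exact hw1 u hu)
        (fun u hu v hv => by
          have : (φ' u - φ u) - (φ' v - φ v) = -(z u - z v) := by simp only [hz]; abel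
          rw [this, norm_neg]
          exact ho u hu v hv)
        (fun u hu => by rw [norm_sub_rev, norm_sub_rev (φ' s)]; exact ho2 u hu)
      rw [norm_sub_rev (φ' s)] at i2
      set a := μ.real (Ioc s t) + μ'.real (Ioc s t) with ha
      have ha0 : 0 ≤ a := by positivity
      have hAa : A t = A s + a := by
        simp only [hAdef, ha, μ, μ', variationMeasure_real_Ioc_add h.boundedVariation hs hst,
          variationMeasure_real_Ioc_add h'.boundedVariation hs hst]
        ring
      have hg : ‖z t‖ ^ 2 - ‖z s‖ ^ 2 ≤ (c * ‖z s‖ ^ 2 + c * κ) * a := by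
        have e1 : ‖z t‖ ^ 2 - ‖z s‖ ^ 2 = inner ℝ (z t + z s) (z t - z s) := by
          rw [inner_sub_right, inner_add_left, inner_add_left, real_inner_self_eq_norm_sq,
            real_inner_self_eq_norm_sq, real_inner_comm (z t) (z s)]
          ring
        have e2 : inner ℝ (z t + z s) (z t - z s) = inner ℝ (z t + z s) (φ t - φ s) +
            inner ℝ ((φ' t - φ t) + (φ' s - φ s)) (φ' t - φ' s) := by
          have : (φ' t - φ t) + (φ' s - φ s) = -(z t + z s) := by simp only [hz]; abel
          rw [this, inner_neg_left, ← sub_eq_add_neg, ← inner_sub_right]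
          congr 1
          simp only [hz]; abel
        rw [e1, e2, ha, mul_add]
        exact add_le_add i1 i2
      have hexp : 1 + c * a ≤ Real.exp (c * a) := by linarith [Real.add_one_le_exp (c * a)]
      have hle : ‖z t‖ ^ 2 + κ ≤ (‖z s‖ ^ 2 + κ) * Real.exp (c * a) := by
        calc _ ≤ (‖z s‖ ^ 2 + κ) * (1 + c * a) := by linarith
          _ ≤ _ := by gcongr
      calc _ ≤ (‖z s‖ ^ 2 + κ) * Real.exp (c * a) * Real.exp (-(c * A t)) := by gcongr
        _ = _ := by
          rw [mul_assoc, ← Real.exp_add, hAa]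
          congr 2
          ring)
  have hfin := key 0 t le_rfl ht.1 ht.2
  have hT : 0 ≤ T := ht.1.trans (ht.2.trans ht₀)
  have hz0 : z 0 = 0 := by simp [hz, h.term_zero hT, h'.term_zero hT]
  have hA0 : A 0 = 0 := by simp [hAdef]
  rw [hz0, hA0, Real.exp_neg, ← div_eq_mul_inv, div_le_iff₀ (Real.exp_pos _)] at hfin
  simp only [norm_zero, ne_eq, OfNat.ofNat_ne_zero, not_false_eq_true, zero_pow, zero_add, mul_zero,
    neg_zero, Real.exp_zero, mul_one] at hfin
  have hexp : κ * Real.exp (c * A t) ≤ κ * Real.exp (c * V) := by gcongr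
  have hκe : κ * Real.exp (c * V) = (ε ^ 2 + r * ε) * Real.exp (c * V) + e := by
    rw [hκ, add_mul, hδ]
    congr 1
    field_simp
  linarith

end IsSkorohodSolution

/-! ### Contraction and Picard iteration under (H2). -/

theorem LinearMap.exists_pos_bound_of_finiteDimensional {E G : Type*} [NormedAddCommGroup E]
    [NormedSpace ℝ E] [FiniteDimensional ℝ E] [NormedAddCommGroup G] [NormedSpace ℝ G]
    (F : E →ₗ[ℝ] G) : ∃ C : ℝ, 0 < C ∧ ∀ a, ‖F a‖ ≤ C * ‖a‖ := by
  refine ⟨‖F.toContinuousLinearMap‖ + 1, by positivity, fun a => ?_⟩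
  refine (F.toContinuousLinearMap.le_opNorm a).trans ?_
  gcongr
  linarith

theorem eVariationOn_Icc_le_of_norm_sub_le {E : Type*} [NormedAddCommGroup E] {f : ℝ → E}
    {H : ℝ → ℝ} {a b : ℝ} (hab : a ≤ b)
    (h : ∀ s t, a ≤ s → s ≤ t → t ≤ b → ‖f t - f s‖ ≤ H t - H s) :
    eVariationOn f (Icc a b) ≤ ENNReal.ofReal (H b - H a) := by
  have hmono : MonotoneOn H (Icc a b) := fun s hs t ht hst =>
    sub_nonneg.1 ((norm_nonneg _).trans (h s t hs.1 hst ht.2))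
  rw [← hmono.eVariationOn_eq (left_mem_Icc.2 hab) (right_mem_Icc.2 hab), inter_self]
  refine iSup_le fun p => le_trans (Finset.sum_le_sum fun i _ => ?_)
    (eVariationOn.sum_le p.2.2.1 p.2.2.2 (n := p.1))
  have hle := p.2.2.1 (Nat.le_succ i)
  have := h _ _ (p.2.2.2 i).1 hle (p.2.2.2 (i + 1)).2
  rw [edist_dist, edist_dist, dist_eq_norm, Real.dist_eq]
  exact ENNReal.ofReal_le_ofReal (this.trans (le_abs_self _))

theorem edist_le_pathOscillation {d : ℕ} (w : ℝ → Euc d) {s t u v : ℝ} (hu : u ∈ Icc s t)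
    (hv : v ∈ Icc u t) : edist (w u) (w v) ≤ pathOscillation w s t :=
  le_iSup₂_of_le u hu (le_iSup₂_of_le v hv le_rfl)

theorem IsSkorohodSolution.congr_path {d : ℕ} {D : Set (Euc d)} {T : ℝ} {w w' ξ φ : ℝ → Euc d}
    (h : IsSkorohodSolution D T w ξ φ) (hw : EqOn w w' (Icc 0 T)) :
    IsSkorohodSolution D T w' ξ φ where
  continuousOn_path := h.continuousOn_path.congr hw.symm
  continuousOn_term := h.continuousOn_term
  boundedVariation := h.boundedVariation
  eq_add t ht := by rw [← hw ht, h.eq_add t ht]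
  mem_closure := h.mem_closure
  reflection := h.reflection

section BoundedVariation

variable {d n : ℕ} {D : Set (Euc d)} {T : ℝ} {y₀ : Euc d} {η : ℝ → Euc d}
  {F : Euc d ⊗[ℝ] Euc n →ₗ[ℝ] Euc d} {x : ℝ → Euc n} {f f' : ℝ → Euc d}
  {I I' : ℝ → Euc d ⊗[ℝ] Euc n}

/-- Formally `d(I - I') = (f - f') ⊗ dx`, so the increment is at most `∫ K exp(l v) dv`, which is
the right-hand side. On short intervals this is `1 + a ≤ exp a` plus a Riemann error `2 ε (v t - v
s)`; chaining preserves the bound, and then `ε` tends to 0. -/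
theorem IsIndefiniteIntegral.norm_increment_sub_le (hv : BoundedVariationOn x (Icc 0 T))
    (hf : ContinuousOn f (Icc 0 T)) (hf' : ContinuousOn f' (Icc 0 T))
    (hI : IsIndefiniteIntegral f x T f x I) (hI' : IsIndefiniteIntegral f' x T f' x I')
    {K l : ℝ} (hK : 0 ≤ K) (hl : 0 < l)
    (hff' : ∀ t ∈ Icc 0 T,
      ‖f t - f' t‖ ≤ K * Real.exp (l * (eVariationOn x (Icc 0 t)).toReal)) :
    ∀ s t, 0 ≤ s → s ≤ t → t ≤ T → ‖(I t - I' t) - (I s - I' s)‖ ≤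
      K / l * Real.exp (l * (eVariationOn x (Icc 0 t)).toReal) -
      K / l * Real.exp (l * (eVariationOn x (Icc 0 s)).toReal) := by
  set v : ℝ → ℝ := fun t => (eVariationOn x (Icc 0 t)).toReal with hvdef
  have hvadd : ∀ s t, 0 ≤ s → s ≤ t → t ≤ T → (eVariationOn x (Icc s t)).toReal = v t - v s :=
    fun s t hs hst ht => by
      rw [hvdef]
      simp only
      rw [← hv.toReal_Icc_add_Icc le_rfl hs hst ht]
      ring
  have hmain : ∀ ε > 0, ∀ s t, 0 ≤ s → s ≤ t → t ≤ T → ‖(I t - I' t) - (I s - I' s)‖ ≤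
      K / l * Real.exp (l * v t) - K / l * Real.exp (l * v s) + 2 * ε * (v t - v s) := by
    intro ε hε
    obtain ⟨δ₁, hδ₁, H₁⟩ := hf.exists_forall_norm_sub_le hε
    obtain ⟨δ₂, hδ₂, H₂⟩ := hf'.exists_forall_norm_sub_le hε
    refine forall_le_of_forall_close (lt_min hδ₁ hδ₂) ?_ ?_
    · intro r s t _ _ _ _ h1 h2
      have := norm_add_le (I t - I' t - (I s - I' s)) (I s - I' s - (I r - I' r))
      rw [sub_add_sub_cancel] at this
      linarith
    · intro s t hs hst ht hlt
      have hmem : ∀ u ∈ Icc s t, u ∈ Icc 0 T := fun u hu => ⟨hs.trans hu.1, hu.2.trans ht⟩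
      have habs : ∀ u ∈ Icc s t, ∀ v ∈ Icc s t, |u - v| < min δ₁ δ₂ := fun u hu v hv => by
        rw [abs_lt]; constructor <;> linarith [hu.1, hu.2, hv.1, hv.2]
      have h1 := hI.cell s s t ε hs le_rfl hst ht fun u hu w hw =>
        H₁ w (hmem w hw) u (hmem u hu) ((habs u hu w hw).trans_le (min_le_left _ _))
      have h2 := hI'.cell s s t ε hs le_rfl hst ht fun u hu w hw =>
        H₂ w (hmem w hw) u (hmem u hu) ((habs u hu w hw).trans_le (min_le_right _ _))
      have h3 : ‖(f s - f' s) ⊗ₜ[ℝ] (x t - x s)‖ ≤ K * Real.exp (l * v s) * (v t - v s) := by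
        rw [TensorProduct.norm_tmul]
        have hxs := hv.norm_sub_le_toReal hs hst ht
        rw [hvadd s t hs hst ht] at hxs
        gcongr
        exact hff' s ⟨hs, hst.trans ht⟩
      rw [hvadd s t hs hst ht] at h1 h2
      have h4 : (I t - I' t) - (I s - I' s) =
          (I t - I s - f s ⊗ₜ[ℝ] (x t - x s)) - (I' t - I' s - f' s ⊗ₜ[ℝ] (x t - x s)) +
          (f s - f' s) ⊗ₜ[ℝ] (x t - x s) := by
        rw [TensorProduct.sub_tmul]
        abel
      have h5 : K * Real.exp (l * v s) * (v t - v s) ≤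
          K / l * Real.exp (l * v t) - K / l * Real.exp (l * v s) := by
        have e1 : l * (v t - v s) + 1 ≤ Real.exp (l * (v t - v s)) := Real.add_one_le_exp _
        have e2 : Real.exp (l * v t) = Real.exp (l * v s) * Real.exp (l * (v t - v s)) := by
          rw [← Real.exp_add]; congr 1; ring
        have e3 : K / l * Real.exp (l * v t) - K / l * Real.exp (l * v s) =
            K / l * Real.exp (l * v s) * (Real.exp (l * (v t - v s)) - 1) := by
          rw [e2]; ring
        have e4 : K * Real.exp (l * v s) * (v t - v s) =
            K / l * Real.exp (l * v s) * (l * (v t - v s)) := by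
          field_simp
        rw [e3, e4]
        gcongr
        linarith
      rw [h4]
      have := (norm_add_le _ _).trans (add_le_add ((norm_sub_le _ _).trans (add_le_add h1 h2)) h3)
      linarith
  intro s t hs hst ht
  have hvst : 0 ≤ v t - v s := by
    rw [← hvadd s t hs hst ht]
    exact ENNReal.toReal_nonneg
  refine le_of_forall_pos_le_add fun e he => ?_
  refine (hmain (e / (2 * (v t - v s + 1))) (by positivity) s t hs hst ht).trans ?_
  gcongr
  rw [← mul_div_assoc, mul_div_mul_left _ _ two_ne_zero, div_mul_eq_mul_div,
    div_le_iff₀ (by positivity)]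
  nlinarith

/-- Both driving paths start at the same point, so (H2) sees only the variation of their difference,
at most `CF (K / l) exp(l v t)`. With `l = 2 C CF` the factor `C CF / l` is 1/2. -/
theorem skorohodTerm_contraction {C : ℝ≥0}
    (hC : ∀ w ξ φ w' ξ' φ' : ℝ → Euc d,
      IsSkorohodSolution D T w ξ φ → IsSkorohodSolution D T w' ξ' φ' →
      ∀ t ∈ Icc 0 T, pathOscillation (fun s => φ s - φ' s) 0 t ≤
        (C : ℝ≥0∞) * (eVariationOn (fun s => w s - w' s) (Icc 0 t) + edist (w 0) (w' 0)))
    {CF : ℝ} (hCF0 : 0 < CF) (hC0 : 0 < C) (hCF : ∀ a, ‖F a‖ ≤ CF * ‖a‖)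
    (hv : BoundedVariationOn x (Icc 0 T))
    (hf : ContinuousOn f (Icc 0 T)) (hf' : ContinuousOn f' (Icc 0 T))
    (hI : IsIndefiniteIntegral f x T f x I) (hI' : IsIndefiniteIntegral f' x T f' x I')
    {ξ φ ξ' φ' : ℝ → Euc d} (h : IsSkorohodSolution D T (fun t => y₀ + η t + F (I t)) ξ φ)
    (h' : IsSkorohodSolution D T (fun t => y₀ + η t + F (I' t)) ξ' φ') {K : ℝ} (hK : 0 ≤ K)
    (hff' : ∀ t ∈ Icc 0 T,
      ‖f t - f' t‖ ≤ K * Real.exp (2 * C * CF * (eVariationOn x (Icc 0 t)).toReal)) :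
    ∀ t ∈ Icc 0 T,
      ‖φ t - φ' t‖ ≤ K / 2 * Real.exp (2 * C * CF * (eVariationOn x (Icc 0 t)).toReal) := by
  intro t ht
  set v : ℝ → ℝ := fun t => (eVariationOn x (Icc 0 t)).toReal with hvdef
  have hC0' : (0 : ℝ) < C := hC0
  set l : ℝ := 2 * C * CF with hl
  have hl0 : 0 < l := by positivity
  have hT : 0 ≤ T := ht.1.trans ht.2
  have hD := hI.norm_increment_sub_le hv hf hf' hI' hK hl0 hff'
  have hvar : eVariationOn (fun s => (y₀ + η s + F (I s)) - (y₀ + η s + F (I' s))) (Icc 0 t) ≤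
      ENNReal.ofReal (CF * (K / l * Real.exp (l * v t)) - CF * (K / l * Real.exp (l * v 0))) := by
    refine eVariationOn_Icc_le_of_norm_sub_le (H := fun t => CF * (K / l * Real.exp (l * v t)))
      ht.1 fun s u hs hsu hu => ?_
    have e : (y₀ + η u + F (I u)) - (y₀ + η u + F (I' u)) -
        ((y₀ + η s + F (I s)) - (y₀ + η s + F (I' s))) =
        F ((I u - I' u) - (I s - I' s)) := by
      simp only [map_sub]; abel
    rw [e, ← mul_sub]
    exact (hCF _).trans (by gcongr; exact hD s u hs hsu (hu.trans ht.2))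
  have hosc := (edist_le_pathOscillation (fun s => φ s - φ' s) (s := 0) (t := t) (u := 0) (v := t)
    ⟨le_rfl, ht.1⟩ ⟨ht.1, le_rfl⟩).trans (hC _ _ _ _ _ _ h h' t ht)
  simp only [h.term_zero hT, h'.term_zero hT, hI.zero, hI'.zero, edist_self, sub_self,
    add_zero] at hosc
  have hE : 0 ≤ CF * (K / l * Real.exp (l * v t)) := by positivity
  have hE0 : 0 ≤ CF * (K / l * Real.exp (l * v 0)) := by positivity
  have hfin : edist 0 (φ t - φ' t) ≤ ENNReal.ofReal (C * (CF * (K / l * Real.exp (l * v t)))) := by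
    refine hosc.trans ?_
    rw [ENNReal.ofReal_mul C.coe_nonneg, ENNReal.ofReal_coe_nnreal]
    gcongr
    exact hvar.trans (ENNReal.ofReal_le_ofReal (by linarith))
  rw [edist_dist, dist_zero_left, ENNReal.ofReal_le_ofReal_iff (by positivity)] at hfin
  refine hfin.trans (le_of_eq ?_)
  rw [hl]
  field_simp
  rfl

theorem exists_isImplicitSkorohodSolution_of_boundedVariationOn (hT : 0 ≤ T)
    (hη : ContinuousOn η (Icc 0 T)) (hη₀ : η 0 = 0) (hy₀ : y₀ ∈ closure D)
    (hx : ContinuousOn x (Icc 0 T)) (hv : BoundedVariationOn x (Icc 0 T))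
    (hD : ConditionH2 D T) :
    ∃ y Φ : ℝ → Euc d, IsImplicitSkorohodSolution D T y₀ η F x y Φ := by
  obtain ⟨-, hsol, C, hC0, hC⟩ := hD
  obtain ⟨CF, hCF0, hCF⟩ := F.exists_pos_bound_of_finiteDimensional
  have hstep : ∀ f : {f : ℝ → Euc d // ContinuousOn f (Icc 0 T)},
      ∃ (φ : {f : ℝ → Euc d // ContinuousOn f (Icc 0 T)}) (I : ℝ → Euc d ⊗[ℝ] Euc n)
        (ξ : ℝ → Euc d), IsIndefiniteIntegral f.1 x T f.1 x I ∧
        IsSkorohodSolution D T (fun t => y₀ + η t + F (I t)) ξ φ.1 := by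
    rintro ⟨f, hf⟩
    obtain ⟨I, hI⟩ := exists_isIndefiniteIntegral_of_integrator hT hf hx hv
    have hIc := hI.continuousOn hv hf hf hx
    obtain ⟨⟨ξ, φ, h⟩, -⟩ := hsol (fun t => y₀ + η t + F (I t))
      ((continuousOn_const.add hη).add (F.continuous_of_finiteDimensional.comp_continuousOn hIc))
      (by simpa [hη₀, hI.zero] using hy₀)
    exact ⟨⟨φ, h.continuousOn_term⟩, I, ξ, hI, h⟩
  choose L I ξ hI hL using hstep
  set v : ℝ → ℝ := fun t => (eVariationOn x (Icc 0 t)).toReal with hvdef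
  set l : ℝ := 2 * C * CF with hl
  have hl0 : 0 ≤ l := by positivity
  have hcontr : ∀ (f f' : {f : ℝ → Euc d // ContinuousOn f (Icc 0 T)}) (K : ℝ), 0 ≤ K →
      (∀ t ∈ Icc 0 T, ‖f.1 t - f'.1 t‖ ≤ K * Real.exp (l * v t)) →
      ∀ t ∈ Icc 0 T, ‖(L f).1 t - (L f').1 t‖ ≤ K / 2 * Real.exp (l * v t) :=
    fun f f' K hK h => skorohodTerm_contraction hC hCF0 hC0 hCF hv f.2 f'.2 (hI f) (hI f') (hL f)
      (hL f') hK h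
  let Φ : ℕ → {f : ℝ → Euc d // ContinuousOn f (Icc 0 T)} :=
    fun m => L^[m] ⟨fun _ => 0, continuousOn_const⟩
  have hΦ : ∀ m, Φ (m + 1) = L (Φ m) := fun m => Function.iterate_succ_apply' L m _
  obtain ⟨K, hK⟩ := isCompact_Icc.exists_bound_of_continuousOn ((Φ 1).2.sub (Φ 0).2)
  have hK0 : 0 ≤ K := (norm_nonneg _).trans (hK 0 ⟨le_rfl, hT⟩)
  have hgeom : ∀ m, ∀ t ∈ Icc 0 T,
      ‖(Φ (m + 1)).1 t - (Φ m).1 t‖ ≤ K * (1 / 2) ^ m * Real.exp (l * v t) := by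
    intro m
    induction m with
    | zero =>
      intro t ht
      have : 1 ≤ Real.exp (l * v t) := Real.one_le_exp (by positivity)
      have := hK t ht
      simp only [pow_zero, mul_one]
      exact this.trans (le_mul_of_one_le_right hK0 ‹_›)
    | succ m ih =>
      intro t ht
      rw [hΦ (m + 1), hΦ m]
      have := hcontr (Φ (m + 1)) (Φ m) _ (by positivity) ih t ht
      rw [hΦ m] at this
      convert this using 2
      ring
  have hdist : ∀ t ∈ Icc 0 T, ∀ m, dist ((Φ m).1 t) ((Φ (m + 1)).1 t) ≤
      (K * Real.exp (l * v t)) * (1 / 2) ^ m := by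
    intro t ht m
    rw [dist_comm, dist_eq_norm]
    exact (hgeom m t ht).trans (by linarith)
  -- Outside `[0,T]` the value 0 is a dummy.
  have hlim : ∀ t, ∃ a, t ∈ Icc 0 T → Filter.Tendsto (fun m => (Φ m).1 t) Filter.atTop (nhds a) := by
    intro t
    by_cases ht : t ∈ Icc 0 T
    · obtain ⟨a, ha⟩ := cauchySeq_tendsto_of_complete
        (cauchySeq_of_le_geometric _ _ (by norm_num) (hdist t ht))
      exact ⟨a, fun _ => ha⟩
    · exact ⟨0, fun h => absurd h ht⟩
  choose Ψ hΨ using hlim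
  have hΨdist : ∀ t ∈ Icc 0 T, ∀ m, ‖(Φ m).1 t - Ψ t‖ ≤ (2 * K * (1 / 2) ^ m) * Real.exp (l * v t) := by
    intro t ht m
    have := dist_le_of_le_geometric_of_tendsto _ _ (by norm_num) (hdist t ht) (hΨ t ht) m
    rw [dist_eq_norm] at this
    refine this.trans (le_of_eq ?_)
    ring
  have hpow : ∀ M : ℝ, Filter.Tendsto (fun m : ℕ => M * (1 / 2 : ℝ) ^ m) Filter.atTop (nhds 0) := by
    intro M
    simpa using (tendsto_pow_atTop_nhds_zero_of_lt_one (r := (1 / 2 : ℝ)) (by norm_num)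
      (by norm_num)).const_mul M
  have hΨc : ContinuousOn Ψ (Icc 0 T) := by
    have hunif : TendstoUniformlyOn (fun m t => (Φ m).1 t) Ψ Filter.atTop (Icc 0 T) := by
      rw [Metric.tendstoUniformlyOn_iff]
      intro ε hε
      filter_upwards [(hpow (2 * K * Real.exp (l * v T))).eventually_lt_const hε] with m hm t ht
      rw [dist_comm, dist_eq_norm]
      refine lt_of_le_of_lt (hΨdist t ht m) (lt_of_le_of_lt ?_ hm)
      have : v t ≤ v T := ENNReal.toReal_mono hv (eVariationOn.mono x (Icc_subset_Icc_right ht.2))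
      rw [mul_right_comm]
      gcongr
    exact hunif.continuousOn (Filter.Eventually.of_forall fun m => (Φ m).2).frequently
  have hfix : EqOn Ψ (L ⟨Ψ, hΨc⟩).1 (Icc 0 T) := by
    intro t ht
    refine tendsto_nhds_unique ((hΨ t ht).comp (Filter.tendsto_add_atTop_nat 1)) ?_
    rw [tendsto_iff_norm_sub_tendsto_zero]
    refine squeeze_zero (fun _ => norm_nonneg _) (fun m => ?_) (hpow (K * Real.exp (l * v t)))
    have := hcontr (Φ m) ⟨Ψ, hΨc⟩ _ (by positivity) (fun s hs => hΨdist s hs m) t ht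
    rw [← hΦ m] at this
    refine this.trans (le_of_eq ?_)
    ring
  -- `Ψ` and its image under `L` are known to agree only on `[0,T]`; the image is taken as the
  -- solution, and the integral of `Ψ` is transferred to it.
  refine ⟨ξ ⟨Ψ, hΨc⟩, (L ⟨Ψ, hΨc⟩).1, (hL _).term_zero hT, I ⟨Ψ, hΨc⟩, fun t ht => ?_, hL _⟩
  exact ((hI ⟨Ψ, hΨc⟩).hasYoungIntegral hv hΨc ht).congr
    (hfix.mono (Icc_subset_Icc_right ht.2))

theorem isImplicitSkorohodSolution_unique_of_boundedVariationOn (hT : 0 ≤ T)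
    (hx : ContinuousOn x (Icc 0 T)) (hv : BoundedVariationOn x (Icc 0 T))
    (hD : ConditionH2 D T) {y Φ y' Φ' : ℝ → Euc d}
    (h : IsImplicitSkorohodSolution D T y₀ η F x y Φ)
    (h' : IsImplicitSkorohodSolution D T y₀ η F x y' Φ') :
    EqOn y y' (Icc 0 T) ∧ EqOn Φ Φ' (Icc 0 T) := by
  obtain ⟨-, hsol, C, hC0, hC⟩ := hD
  obtain ⟨CF, hCF0, hCF⟩ := F.exists_pos_bound_of_finiteDimensional
  obtain ⟨-, I, hI, hS⟩ := h
  obtain ⟨-, I', hI', hS'⟩ := h'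
  obtain ⟨J, hJ⟩ := exists_isIndefiniteIntegral_of_integrator hT hS.continuousOn_term hx hv
  obtain ⟨J', hJ'⟩ := exists_isIndefiniteIntegral_of_integrator hT hS'.continuousOn_term hx hv
  have hIJ : ∀ t ∈ Icc 0 T, I t = J t := fun t ht =>
    (hI t ht).unique ht.1 (hJ.hasYoungIntegral hv hS.continuousOn_term ht)
  have hIJ' : ∀ t ∈ Icc 0 T, I' t = J' t := fun t ht =>
    (hI' t ht).unique ht.1 (hJ'.hasYoungIntegral hv hS'.continuousOn_term ht)
  have hSJ := hS.congr_path (w' := fun t => y₀ + η t + F (J t)) fun t ht => by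
    simp only [hIJ t ht]
  have hSJ' := hS'.congr_path (w' := fun t => y₀ + η t + F (J' t)) fun t ht => by
    simp only [hIJ' t ht]
  set v : ℝ → ℝ := fun t => (eVariationOn x (Icc 0 t)).toReal with hvdef
  set l : ℝ := 2 * C * CF with hl
  have hl0 : 0 ≤ l := by positivity
  obtain ⟨K, hK⟩ := isCompact_Icc.exists_bound_of_continuousOn
    (hS.continuousOn_term.sub hS'.continuousOn_term)
  have hK0 : 0 ≤ K := (norm_nonneg _).trans (hK 0 ⟨le_rfl, hT⟩)
  -- Each use of the contraction halves the bound on the distance between the two solutions, so that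
  -- distance is zero.
  have hgeom : ∀ m : ℕ, ∀ t ∈ Icc 0 T, ‖Φ t - Φ' t‖ ≤ K * (1 / 2) ^ m * Real.exp (l * v t) := by
    intro m
    induction m with
    | zero =>
      intro t ht
      have : 1 ≤ Real.exp (l * v t) := Real.one_le_exp (by positivity)
      simp only [pow_zero, mul_one]
      exact (hK t ht).trans (le_mul_of_one_le_right hK0 this)
    | succ m ih =>
      intro t ht
      refine (skorohodTerm_contraction hC hCF0 hC0 hCF hv hS.continuousOn_term
        hS'.continuousOn_term hJ hJ' hSJ hSJ' (by positivity) ih t ht).trans (le_of_eq ?_)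
      ring
  have hΦ : EqOn Φ Φ' (Icc 0 T) := by
    intro t ht
    refine eq_of_norm_sub_le_zero (ge_of_tendsto' (x := Filter.atTop) ?_ fun m => hgeom m t ht)
    simpa using ((tendsto_pow_atTop_nhds_zero_of_lt_one (r := (1 / 2 : ℝ)) (by norm_num)
      (by norm_num)).const_mul K).mul_const (Real.exp (l * v t))
  refine ⟨fun t ht => ?_, hΦ⟩
  have hII : I t = I' t := ((hI t ht).congr (hΦ.mono (Icc_subset_Icc_right ht.2))).unique ht.1
    (hI' t ht)
  rw [hS.eq_add t ht, hS'.eq_add t ht, hII, hΦ ht]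

end BoundedVariation

/-! ### Left Riemann sums on a uniform grid. -/

/-- The left Riemann sum of `∫_0^t f ⊗ dx` along the grid `0, h, 2h, …, N h`, stopped at `t`. -/
noncomputable def leftRiemannSum {d n : ℕ} (f : ℝ → Euc d) (x : ℝ → Euc n) (h : ℝ) (N : ℕ) (t : ℝ) :
    Euc d ⊗[ℝ] Euc n :=
  ∑ j ∈ Finset.range N,
    f (min t (j * h)) ⊗ₜ[ℝ] (x (min t ((j + 1 : ℕ) * h)) - x (min t (j * h)))

/-- Abel summation moves the increments from the merely continuous path to the one of bounded
variation. -/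
theorem sum_range_tmul_sub {d n : ℕ} (g : ℕ → Euc d) (c : ℕ → Euc n) (N : ℕ) :
    ∑ j ∈ Finset.range N, g j ⊗ₜ[ℝ] (c (j + 1) - c j) =
      g N ⊗ₜ[ℝ] c N - g 0 ⊗ₜ[ℝ] c 0 -
        ∑ j ∈ Finset.range N, (g (j + 1) - g j) ⊗ₜ[ℝ] c (j + 1) := by
  induction N with
  | zero => simp
  | succ N ih =>
    rw [Finset.sum_range_succ, ih, Finset.sum_range_succ, TensorProduct.tmul_sub,
      TensorProduct.sub_tmul]
    abel

theorem BoundedVariationOn.sum_norm_sub_le {E : Type*} [NormedAddCommGroup E] {f : ℝ → E}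
    {s : Set ℝ} (hf : BoundedVariationOn f s) {u : ℕ → ℝ} (hu : Monotone u) (hus : ∀ i, u i ∈ s)
    (N : ℕ) : ∑ j ∈ Finset.range N, ‖f (u (j + 1)) - f (u j)‖ ≤ (eVariationOn f s).toReal := by
  have h := eVariationOn.sum_le hu hus (f := f) (n := N)
  rw [← ENNReal.ofReal_le_iff_le_toReal hf]
  refine le_trans (le_of_eq ?_) h
  rw [ENNReal.ofReal_sum_of_nonneg fun _ _ => norm_nonneg _]
  exact Finset.sum_congr rfl fun j _ => by rw [edist_dist, dist_eq_norm]

section LeftRiemannSum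

variable {d n : ℕ} {f g : ℝ → Euc d} {x : ℝ → Euc n} {T h : ℝ} {N : ℕ}

theorem monotone_min_mul (hh : 0 ≤ h) (t : ℝ) : Monotone fun j : ℕ => min t (j * h) :=
  fun i j hij => min_le_min_left t (by gcongr)

theorem min_mul_mem_Icc (hh : 0 ≤ h) {t : ℝ} (ht : 0 ≤ t) (j : ℕ) : min t (j * h) ∈ Icc 0 t :=
  ⟨le_min ht (by positivity), min_le_left _ _⟩

theorem leftRiemannSum_zero (hh : 0 ≤ h) : leftRiemannSum f x h N 0 = 0 := by
  refine Finset.sum_eq_zero fun j _ => ?_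
  rw [min_eq_left (by positivity), min_eq_left (by positivity), sub_self, TensorProduct.tmul_zero]

theorem continuousOn_leftRiemannSum (hh : 0 ≤ h) (hf : ContinuousOn f (Icc 0 T))
    (hx : ContinuousOn x (Icc 0 T)) : ContinuousOn (leftRiemannSum f x h N) (Icc 0 T) := by
  have hm : ∀ j : ℕ, ContinuousOn (fun t : ℝ => min t (j * h)) (Icc 0 T) := fun j =>
    (continuous_id.min continuous_const).continuousOn
  have hmaps : ∀ j : ℕ, MapsTo (fun t : ℝ => min t (j * h)) (Icc 0 T) (Icc 0 T) := fun j t ht =>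
    Icc_subset_Icc_right ht.2 (min_mul_mem_Icc hh ht.1 j)
  refine continuousOn_finsetSum _ fun j _ => ?_
  exact TensorProduct.continuous_tmul.comp_continuousOn ((hf.comp (hm j) (hmaps j)).prodMk
    ((hx.comp (hm (j + 1)) (hmaps (j + 1))).sub (hx.comp (hm j) (hmaps j))))

/-- The sum looks back to grid points: before time `(k + 1) h` only tags up to `k h` carry a nonzero
increment of `x`. This makes the scheme solvable cell by cell. -/
theorem leftRiemannSum_congr (hh : 0 ≤ h) {k : ℕ} (hfg : EqOn f g (Icc 0 (k * h))) {t : ℝ}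
    (ht0 : 0 ≤ t) (ht : t ≤ (k + 1 : ℕ) * h) :
    leftRiemannSum f x h N t = leftRiemannSum g x h N t := by
  refine Finset.sum_congr rfl fun j _ => ?_
  rcases Nat.lt_or_ge k j with hj | hj
  · have h1 : t ≤ j * h := ht.trans (by gcongr; exact hj)
    have h2 : t ≤ (j + 1 : ℕ) * h := h1.trans (by gcongr; omega)
    rw [min_eq_left h1, min_eq_left h2, sub_self, TensorProduct.tmul_zero, TensorProduct.tmul_zero]
  · rw [hfg ⟨(min_mul_mem_Icc hh ht0 j).1, (min_le_right _ _).trans (by gcongr)⟩]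

/-- After Abel summation only the oscillation of `x` on `[s,t]` enters, as `c j` vanishes while `j h
≤ s`. The boundary term and the sum each cost one variation of `f`, hence the factor 2; the bound
does not depend on `N`. -/
theorem norm_leftRiemannSum_sub_le (hh : 0 ≤ h) (hN : N * h = T) (hf0 : f 0 = 0)
    (hf : BoundedVariationOn f (Icc 0 T)) {s t κ : ℝ} (hs : 0 ≤ s) (hst : s ≤ t) (ht : t ≤ T)
    (hκ : ∀ u ∈ Icc s t, ∀ v ∈ Icc s t, ‖x u - x v‖ ≤ κ) :
    ‖leftRiemannSum f x h N t - leftRiemannSum f x h N s‖ ≤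
      2 * (eVariationOn f (Icc 0 t)).toReal * κ := by
  have ht0 := hs.trans hst
  have hfv : BoundedVariationOn f (Icc 0 t) := hf.mono (Icc_subset_Icc_right ht)
  set g : ℕ → Euc d := fun j => f (min t (j * h)) with hg
  set c : ℕ → Euc n := fun j => x (min t (j * h)) - x (min s (j * h)) with hc
  have hcκ : ∀ j, ‖c j‖ ≤ κ := by
    intro j
    rcases le_total (j * h : ℝ) s with hj | hj
    · have : c j = 0 := by simp only [hc]; rw [min_eq_right hj, min_eq_right (hj.trans hst), sub_self]
      rw [this, norm_zero]
      exact (norm_nonneg _).trans (hκ s ⟨le_rfl, hst⟩ s ⟨le_rfl, hst⟩)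
    · simp only [hc]
      rw [min_eq_left hj]
      exact hκ _ ⟨le_min hst hj, min_le_left _ _⟩ _ ⟨le_rfl, hst⟩
  have hκ0 : 0 ≤ κ := (norm_nonneg _).trans (hcκ 0)
  have hdiff : leftRiemannSum f x h N t - leftRiemannSum f x h N s =
      ∑ j ∈ Finset.range N, g j ⊗ₜ[ℝ] (c (j + 1) - c j) := by
    rw [leftRiemannSum, leftRiemannSum, ← Finset.sum_sub_distrib]
    refine Finset.sum_congr rfl fun j _ => ?_
    -- The tags stopped at `s` and at `t` can differ only where the increment of `x` stopped at `s`
    -- is zero.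
    have hrep : f (min s (j * h)) ⊗ₜ[ℝ] (x (min s ((j + 1 : ℕ) * h)) - x (min s (j * h))) =
        g j ⊗ₜ[ℝ] (x (min s ((j + 1 : ℕ) * h)) - x (min s (j * h))) := by
      rcases le_total (j * h : ℝ) s with hj | hj
      · simp only [hg]
        rw [min_eq_right hj, min_eq_right (hj.trans hst)]
      · have h2 : s ≤ (j + 1 : ℕ) * h := hj.trans (by gcongr; omega)
        rw [min_eq_left hj, min_eq_left h2, sub_self, TensorProduct.tmul_zero,
          TensorProduct.tmul_zero]
    rw [hrep, ← TensorProduct.tmul_sub]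
    congr 1
    simp only [hc]
    abel
  have hc0 : c 0 = 0 := by simp [hc, hs, ht0]
  have hgN : ‖g N‖ ≤ (eVariationOn f (Icc 0 t)).toReal := by
    have := hfv.norm_sub_le_toReal le_rfl ht0 le_rfl
    simp only [hg]
    rwa [hN, min_eq_left ht, ← sub_zero (f t), ← hf0]
  have hsum := hfv.sum_norm_sub_le (monotone_min_mul hh t) (min_mul_mem_Icc hh ht0) N
  rw [hdiff, sum_range_tmul_sub, hc0, TensorProduct.tmul_zero, sub_zero]
  calc _ ≤ ‖g N‖ * ‖c N‖ + ∑ j ∈ Finset.range N, ‖g (j + 1) - g j‖ * ‖c (j + 1)‖ := by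
        refine (norm_sub_le _ _).trans (add_le_add (TensorProduct.norm_tmul _ _).le ?_)
        exact (norm_sum_le _ _).trans
          (Finset.sum_le_sum fun j _ => (TensorProduct.norm_tmul _ _).le)
    _ ≤ (eVariationOn f (Icc 0 t)).toReal * κ +
        ∑ j ∈ Finset.range N, ‖g (j + 1) - g j‖ * κ := by
        gcongr with j _
        · exact hcκ N
        · exact hcκ (j + 1)
    _ ≤ (eVariationOn f (Icc 0 t)).toReal * κ + (eVariationOn f (Icc 0 t)).toReal * κ := by
        rw [← Finset.sum_mul]
        gcongr
    _ = _ := by ring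

theorem norm_leftRiemannSum_sub_integral_le (hh : 0 ≤ h) (hN : N * h = T)
    (hf : BoundedVariationOn f (Icc 0 T)) {I : ℝ → Euc d ⊗[ℝ] Euc n}
    (hI : IsIndefiniteIntegral x f T f x I) {κ : ℝ}
    (hκ : ∀ u ∈ Icc 0 T, ∀ v ∈ Icc 0 T, |u - v| ≤ h → ‖x u - x v‖ ≤ κ) {t : ℝ}
    (ht : t ∈ Icc 0 T) :
    ‖leftRiemannSum f x h N t - I t‖ ≤ κ * (eVariationOn f (Icc 0 T)).toReal := by
  have hκ0 : 0 ≤ κ := (norm_nonneg _).trans (hκ t ht t ht (by simpa using hh))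
  have hend : min t (N * h) = t := by rw [hN]; exact min_eq_left ht.2
  have hstart : min t ((0 : ℕ) * h) = 0 := by simp [ht.1]
  have hcell : ∀ j : ℕ, min t ((j + 1 : ℕ) * h) ≤ min t (j * h) + h := by
    intro j
    rw [← min_add_add_right]
    refine min_le_min (by linarith) (le_of_eq ?_)
    push_cast; ring
  have key := hI.norm_riemannSum_sub_le hf (ε := κ) (t := fun j : ℕ => min t (j * h))
    (τ := fun j : ℕ => min t (j * h)) hstart.ge N (by simp only [hend]; exact ht.2)
    (fun k _ => ⟨le_rfl, monotone_min_mul hh t (Nat.le_succ k)⟩) (by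
      intro k _ u hu v hv
      have h1 := min_mul_mem_Icc hh ht.1 k
      have h2 := min_mul_mem_Icc hh ht.1 (k + 1)
      have h3 := hcell k
      refine hκ u ⟨h1.1.trans hu.1, hu.2.trans (h2.2.trans ht.2)⟩ v
        ⟨h1.1.trans hv.1, hv.2.trans (h2.2.trans ht.2)⟩ ?_
      rw [abs_le]
      constructor <;> linarith [hu.1, hu.2, hv.1, hv.2])
  simp only [hend, hstart, hI.zero, sub_zero] at key
  refine key.trans ?_
  gcongr
  exact eVariationOn.mono f (Icc_subset_Icc_right ht.2)

theorem norm_leftRiemannSum_sub_leftRiemannSum_le (hh : 0 ≤ h) {κ ρ : ℝ}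
    (hκ : ∀ u ∈ Icc 0 T, ∀ v ∈ Icc 0 T, |u - v| ≤ h → ‖x u - x v‖ ≤ κ)
    (hρ : ∀ u ∈ Icc 0 T, ‖f u - g u‖ ≤ ρ) {t : ℝ} (ht : t ∈ Icc 0 T) :
    ‖leftRiemannSum f x h N t - leftRiemannSum g x h N t‖ ≤ N * (ρ * κ) := by
  have hmem : ∀ j : ℕ, min t (j * h) ∈ Icc 0 T := fun j =>
    Icc_subset_Icc_right ht.2 (min_mul_mem_Icc hh ht.1 j)
  have hρ0 : 0 ≤ ρ := (norm_nonneg _).trans (hρ t ht)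
  rw [leftRiemannSum, leftRiemannSum, ← Finset.sum_sub_distrib]
  refine (norm_sum_le _ _).trans ((Finset.sum_le_card_nsmul _ _ (ρ * κ) fun j _ => ?_).trans ?_)
  · rw [← TensorProduct.sub_tmul, TensorProduct.norm_tmul]
    gcongr
    · exact hρ _ (hmem j)
    · refine hκ _ (hmem (j + 1)) _ (hmem j) ?_
      have h1 : min t ((j + 1 : ℕ) * h) ≤ min t (j * h) + h := by
        rw [← min_add_add_right]
        refine min_le_min (by linarith) (le_of_eq ?_)
        push_cast; ring
      have h2 := monotone_min_mul hh t (Nat.le_succ j)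
      simp only at h2
      rw [abs_le]
      constructor <;> linarith
  · rw [Finset.card_range, nsmul_eq_mul]

end LeftRiemannSum

/-! ### Compactness and lower semicontinuity of variation. -/

/-- Arzelà–Ascoli for sequences of functions on a compact interval. -/
theorem exists_subseq_tendstoUniformlyOn_Icc {E : Type*} [NormedAddCommGroup E] [ProperSpace E]
    {a b M : ℝ} (hab : a ≤ b) {φ : ℕ → ℝ → E} (hM : ∀ k, ∀ t ∈ Icc a b, ‖φ k t‖ ≤ M)
    (hφ : ∀ ε > 0, ∃ δ > 0, ∀ k, ∀ s t, a ≤ s → s ≤ t → t ≤ b → t - s < δ →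
      ‖φ k t - φ k s‖ ≤ ε) :
    ∃ Ψ : ℝ → E, ∃ σ : ℕ → ℕ, StrictMono σ ∧ ContinuousOn Ψ (Icc a b) ∧
      TendstoUniformlyOn (fun k => φ (σ k)) Ψ Filter.atTop (Icc a b) := by
  have hmod : ∀ ε > 0, ∃ δ > 0, ∀ k, ∀ s ∈ Icc a b, ∀ t ∈ Icc a b, dist s t < δ →
      dist (φ k s) (φ k t) < ε := by
    intro ε hε
    obtain ⟨δ, hδ, H⟩ := hφ (ε / 2) (by positivity)
    refine ⟨δ, hδ, fun k s hs t ht hst => ?_⟩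
    rw [Real.dist_eq, abs_lt] at hst
    rcases le_total s t with hle | hle
    · rw [dist_comm, dist_eq_norm]
      exact (H k s t hs.1 hle ht.2 (by linarith)).trans_lt (by linarith)
    · rw [dist_eq_norm]
      exact (H k t s ht.1 hle hs.2 (by linarith)).trans_lt (by linarith)
  have hc : ∀ k, ContinuousOn (φ k) (Icc a b) := fun k => by
    rw [Metric.continuousOn_iff]
    intro t ht ε hε
    obtain ⟨δ, hδ, H⟩ := hmod ε hε
    exact ⟨δ, hδ, fun s hs hst => H k s hs t ht hst⟩
  let g : ℕ → BoundedContinuousFunction (Icc a b) E := fun k =>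
    BoundedContinuousFunction.mkOfCompact ⟨(Icc a b).domRestrict (φ k), (hc k).domRestrict⟩
  have hg : ∀ k (t : Icc a b), g k t = φ k t := fun k t => rfl
  have hcomp := BoundedContinuousFunction.arzela_ascoli (Metric.closedBall (0 : E) M)
    (isCompact_closedBall 0 M) (range g) (by
      rintro f t ⟨k, rfl⟩
      rw [mem_closedBall_zero_iff, hg]
      exact hM k t t.2) (by
      intro t
      rw [Metric.equicontinuousAt_iff]
      intro ε hε
      obtain ⟨δ, hδ, H⟩ := hmod ε hε
      refine ⟨δ, hδ, ?_⟩
      rintro s hst ⟨f, k, rfl⟩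
      rw [dist_comm] at hst
      exact H k t t.2 s s.2 hst)
  obtain ⟨ψ, -, σ, hσ, hlim⟩ :=
    hcomp.tendsto_subseq fun k => subset_closure (mem_range_self k)
  have hψ : ∀ t (ht : t ∈ Icc a b), IccExtend hab ψ t = ψ ⟨t, ht⟩ := fun t ht =>
    IccExtend_of_mem hab _ ht
  refine ⟨IccExtend hab ψ, σ, hσ, ψ.continuous.Icc_extend'.continuousOn, ?_⟩
  rw [BoundedContinuousFunction.tendsto_iff_tendstoUniformly, Metric.tendstoUniformly_iff] at hlim
  rw [Metric.tendstoUniformlyOn_iff]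
  intro ε hε
  filter_upwards [hlim ε hε] with k hk t ht
  rw [hψ t ht]
  exact hk ⟨t, ht⟩

theorem eVariationOn_le_of_tendsto {E : Type*} [PseudoEMetricSpace E] {φ : ℕ → ℝ → E} {Ψ : ℝ → E}
    {s : Set ℝ} {M : ℝ≥0∞} (h : ∀ t ∈ s, Filter.Tendsto (fun k => φ k t) Filter.atTop (nhds (Ψ t)))
    (hM : ∀ k, eVariationOn (φ k) s ≤ M) : eVariationOn Ψ s ≤ M := by
  by_contra hlt
  obtain ⟨k, hk⟩ := (eVariationOn.lowerSemicontinuous_aux h (not_le.1 hlt)).exists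
  exact absurd (hM k) (not_le.2 hk)

/-! ### The Euler scheme and its uniform variation bound. -/

section Euler

variable {d n : ℕ} {D : Set (Euc d)} {T : ℝ} {y₀ : Euc d} {η : ℝ → Euc d}
  {F : Euc d ⊗[ℝ] Euc n →ₗ[ℝ] Euc d} {x : ℝ → Euc n}

/-- The Euler scheme for the implicit Skorohod equation has a solution. -/
theorem exists_isSkorohodSolution_leftRiemannSum (hA : ConditionA D)
    (hsol : SkorohodUniquelySolvable D T) (hη : ContinuousOn η (Icc 0 T)) (hη₀ : η 0 = 0)
    (hy₀ : y₀ ∈ closure D) (hx : ContinuousOn x (Icc 0 T)) {h : ℝ} (hh : 0 ≤ h) {N : ℕ}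
    (hN : N * h = T) :
    ∃ ξ φ : ℝ → Euc d,
      IsSkorohodSolution D T (fun t => y₀ + η t + F (leftRiemannSum φ x h N t)) ξ φ := by
  have hT : 0 ≤ T := hN ▸ by positivity
  obtain ⟨r, hr, hAr⟩ := hA
  have hstep : ∀ f : {f : ℝ → Euc d // ContinuousOn f (Icc 0 T)},
      ∃ (φ : {f : ℝ → Euc d // ContinuousOn f (Icc 0 T)}) (ξ : ℝ → Euc d),
        IsSkorohodSolution D T (fun t => y₀ + η t + F (leftRiemannSum f.1 x h N t)) ξ φ.1 := by
    rintro ⟨f, hf⟩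
    obtain ⟨⟨ξ, φ, h⟩, -⟩ := hsol (fun t => y₀ + η t + F (leftRiemannSum f x h N t))
      ((continuousOn_const.add hη).add (F.continuous_of_finiteDimensional.comp_continuousOn
        (continuousOn_leftRiemannSum hh hf hx)))
      (by simpa [hη₀, leftRiemannSum_zero hh] using hy₀)
    exact ⟨⟨φ, h.continuousOn_term⟩, ξ, h⟩
  choose L ξ hL using hstep
  let Φ : ℕ → {f : ℝ → Euc d // ContinuousOn f (Icc 0 T)} :=
    fun m => L^[m] ⟨fun _ => 0, continuousOn_const⟩
  have hΦ : ∀ m, Φ (m + 1) = L (Φ m) := fun m => Function.iterate_succ_apply' L m _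
  have hΦ0 : ∀ m, (Φ m).1 0 = 0 := by
    intro m
    cases m with
    | zero => rfl
    | succ m => rw [hΦ m]; exact (hL _).term_zero hT
  -- The iterates stabilise on one more cell at each step. Uniqueness is needed on `[0,(k + 1) h]`
  -- rather than `[0,T]`, so it is taken from the stability estimate with `ε = 0`.
  have heq : ∀ k : ℕ, k ≤ N → EqOn (Φ k).1 (Φ (k + 1)).1 (Icc 0 (k * h)) := by
    intro k
    induction k with
    | zero =>
      intro _ t ht
      have ht0 : t = 0 := le_antisymm (by simpa using ht.2) ht.1
      rw [ht0, hΦ0, hΦ0]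
    | succ k ih =>
      intro hk t ht
      have hkT : (k + 1 : ℕ) * h ≤ T := by rw [← hN]; gcongr
      have key := (hL (Φ k)).norm_sub_sq_le (hL (Φ (k + 1))) hr (fun x hx => (hAr x hx).1) hkT
        le_rfl (fun s hs => by
          rw [leftRiemannSum_congr hh (ih (by omega)) hs.1 hs.2, sub_self, norm_zero]) t ht
      rw [← hΦ k, ← hΦ (k + 1)] at key
      simp only [ne_eq, OfNat.ofNat_ne_zero, not_false_eq_true, zero_pow, mul_zero, add_zero,
        zero_mul] at key
      have : ‖(Φ (k + 1)).1 t - (Φ (k + 1 + 1)).1 t‖ = 0 :=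
        pow_eq_zero_iff (two_ne_zero) |>.1 (le_antisymm key (by positivity))
      exact sub_eq_zero.1 (norm_eq_zero.1 this)
  refine ⟨ξ (Φ N), (L (Φ N)).1, (hL (Φ N)).congr_path fun t ht => ?_⟩
  have htN : t ≤ (N + 1 : ℕ) * h := ht.2.trans (by rw [← hN]; gcongr; omega)
  have := heq N le_rfl
  rw [hΦ N] at this
  simp only
  rw [leftRiemannSum_congr hh this ht.1 htN]

section Bound

variable {C : ℝ≥0} {CF h : ℝ} {N : ℕ} {ξ φ : ℝ → Euc d}

/-- (H1) applied to the Euler path, whose oscillation comes from `η` and from the Riemann sum. The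
variation of `φ` on `[0,t]` returns on the right, but multiplied by the small oscillation `κ` of
`x`. -/
theorem toReal_eVariationOn_le_of_leftRiemannSum
    (hC : ∀ w ξ φ : ℝ → Euc d, IsSkorohodSolution D T w ξ φ →
      ∀ s t : ℝ, 0 ≤ s → s ≤ t → t ≤ T →
        eVariationOn φ (Icc s t) ≤ (C : ℝ≥0∞) * pathOscillation w s t)
    (hCF0 : 0 ≤ CF) (hCF : ∀ a, ‖F a‖ ≤ CF * ‖a‖) (hh : 0 ≤ h) (hN : N * h = T)
    (hS : IsSkorohodSolution D T (fun t => y₀ + η t + F (leftRiemannSum φ x h N t)) ξ φ)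
    {s t κ κ' : ℝ} (hs : 0 ≤ s) (hst : s ≤ t) (ht : t ≤ T)
    (hκ : ∀ u ∈ Icc s t, ∀ v ∈ Icc s t, ‖x u - x v‖ ≤ κ)
    (hκ' : ∀ u ∈ Icc s t, ∀ v ∈ Icc s t, ‖η u - η v‖ ≤ κ') :
    (eVariationOn φ (Icc s t)).toReal ≤
      C * (κ' + CF * (2 * (eVariationOn φ (Icc 0 t)).toReal * κ)) := by
  have hT : 0 ≤ T := hs.trans (hst.trans ht)
  have hκ0 : 0 ≤ κ := (norm_nonneg _).trans (hκ s ⟨le_rfl, hst⟩ s ⟨le_rfl, hst⟩)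
  have hκ'0 : 0 ≤ κ' := (norm_nonneg _).trans (hκ' s ⟨le_rfl, hst⟩ s ⟨le_rfl, hst⟩)
  have hosc : pathOscillation (fun t => y₀ + η t + F (leftRiemannSum φ x h N t)) s t ≤
      ENNReal.ofReal (κ' + CF * (2 * (eVariationOn φ (Icc 0 t)).toReal * κ)) := by
    refine iSup₂_le fun u hu => iSup₂_le fun v hv => ?_
    rw [edist_comm, edist_dist, dist_eq_norm]
    refine ENNReal.ofReal_le_ofReal ?_
    have hvt : v ∈ Icc s t := ⟨hu.1.trans hv.1, hv.2⟩
    have e : (y₀ + η v + F (leftRiemannSum φ x h N v)) -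
        (y₀ + η u + F (leftRiemannSum φ x h N u)) =
        (η v - η u) + F (leftRiemannSum φ x h N v - leftRiemannSum φ x h N u) := by
      rw [map_sub]; abel
    have h1 := norm_leftRiemannSum_sub_le (x := x) hh hN (hS.term_zero hT) hS.boundedVariation
      (hs.trans hu.1) hv.1 (hv.2.trans ht) (fun a ha b hb => hκ a ⟨hu.1.trans ha.1, ha.2.trans hv.2⟩
        b ⟨hu.1.trans hb.1, hb.2.trans hv.2⟩)
    have h2 : (eVariationOn φ (Icc 0 v)).toReal ≤ (eVariationOn φ (Icc 0 t)).toReal :=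
      ENNReal.toReal_mono (hS.boundedVariation.mono (Icc_subset_Icc_right ht))
        (eVariationOn.mono φ (Icc_subset_Icc_right hv.2))
    rw [e]
    refine (norm_add_le _ _).trans (add_le_add (hκ' v hvt u hu) ((hCF _).trans ?_))
    gcongr
    exact h1.trans (by gcongr)
  refine ENNReal.toReal_le_of_le_ofReal (by positivity) ?_
  rw [ENNReal.ofReal_mul C.coe_nonneg, ENNReal.ofReal_coe_nnreal]
  exact (hC _ _ _ hS s t hs hst ht).trans (by gcongr)

/-- Write `V` for the variation of `φ` from 0. As `4 C CF κ ≤ 1`, a step of length `δ` gives `V t -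
V s ≤ C + V t / 2`, so `V + 2 C` at most doubles. The number of steps depends on `δ` and not on the
grid. -/
theorem toReal_eVariationOn_le_pow_of_leftRiemannSum
    (hC : ∀ w ξ φ : ℝ → Euc d, IsSkorohodSolution D T w ξ φ →
      ∀ s t : ℝ, 0 ≤ s → s ≤ t → t ≤ T →
        eVariationOn φ (Icc s t) ≤ (C : ℝ≥0∞) * pathOscillation w s t)
    (hCF0 : 0 ≤ CF) (hCF : ∀ a, ‖F a‖ ≤ CF * ‖a‖) (hh : 0 ≤ h) (hN : N * h = T)
    (hS : IsSkorohodSolution D T (fun t => y₀ + η t + F (leftRiemannSum φ x h N t)) ξ φ)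
    {δ κ : ℝ} (hδ : 0 < δ) (hκC : 4 * C * CF * κ ≤ 1) {m : ℕ} (hm : T ≤ m * δ)
    (hκ : ∀ u ∈ Icc 0 T, ∀ v ∈ Icc 0 T, |u - v| ≤ δ → ‖x u - x v‖ ≤ κ)
    (hη : ∀ u ∈ Icc 0 T, ∀ v ∈ Icc 0 T, |u - v| ≤ δ → ‖η u - η v‖ ≤ 1) :
    (eVariationOn φ (Icc 0 T)).toReal ≤ 2 ^ m * (2 * C) := by
  have hT : 0 ≤ T := hN ▸ by positivity
  have key : ∀ k : ℕ, (eVariationOn φ (Icc 0 (min (k * δ) T))).toReal + 2 * C ≤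
      2 ^ k * (2 * C) := by
    intro k
    induction k with
    | zero => simp [eVariationOn.subsingleton, hT]
    | succ k ih =>
      set s := min (k * δ) T with hs
      set t := min ((k + 1 : ℕ) * δ) T with ht
      have hs0 : 0 ≤ s := le_min (by positivity) hT
      have hst : s ≤ t := min_le_min_right T (by gcongr; omega)
      have htT : t ≤ T := min_le_right _ _
      have hts : t ≤ s + δ := by
        rw [hs, ← min_add_add_right]
        refine min_le_min (le_of_eq ?_) (by linarith)
        push_cast; ring
      have hmem : ∀ u ∈ Icc s t, u ∈ Icc 0 T := fun u hu => ⟨hs0.trans hu.1, hu.2.trans htT⟩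
      have habs : ∀ u ∈ Icc s t, ∀ v ∈ Icc s t, |u - v| ≤ δ := fun u hu v hv => by
        rw [abs_le]; constructor <;> linarith [hu.1, hu.2, hv.1, hv.2]
      have h1 := toReal_eVariationOn_le_of_leftRiemannSum hC hCF0 hCF hh hN hS hs0 hst htT
        (fun u hu v hv => hκ u (hmem u hu) v (hmem v hv) (habs u hu v hv))
        (fun u hu v hv => hη u (hmem u hu) v (hmem v hv) (habs u hu v hv))
      have h2 := hS.boundedVariation.toReal_Icc_add_Icc le_rfl hs0 hst htT
      have h3 : 4 * C * CF * κ * (eVariationOn φ (Icc 0 t)).toReal ≤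
          1 * (eVariationOn φ (Icc 0 t)).toReal := by gcongr
      rw [pow_succ]
      nlinarith
  have := key m
  rw [min_eq_right hm] at this
  have hC0 : (0 : ℝ) ≤ C := C.coe_nonneg
  linarith

end Bound

end Euler

/-! ### Passage to the limit under (H1). -/

section Convergence

variable {d n : ℕ} {T : ℝ} {x : ℝ → Euc n}

/-- Left Riemann sums along grids of vanishing mesh, of integrands of uniformly bounded variation
that converge uniformly, converge uniformly to the integral of the limit. -/
theorem tendstoUniformlyOn_leftRiemannSum (hT : 0 < T) (hx : ContinuousOn x (Icc 0 T)) {M : ℝ}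
    {φ : ℕ → ℝ → Euc d} {Ψ : ℝ → Euc d} {N : ℕ → ℕ} {h : ℕ → ℝ} (hNh : ∀ k, N k * h k = T)
    (hh : Filter.Tendsto h Filter.atTop (nhds 0)) (hh0 : ∀ k, 0 ≤ h k)
    (hφc : ∀ k, ContinuousOn (φ k) (Icc 0 T))
    (hφv : ∀ k, BoundedVariationOn (φ k) (Icc 0 T))
    (hφM : ∀ k, (eVariationOn (φ k) (Icc 0 T)).toReal ≤ M)
    (hΨv : BoundedVariationOn Ψ (Icc 0 T)) (hΨM : (eVariationOn Ψ (Icc 0 T)).toReal ≤ M)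
    (hφΨ : TendstoUniformlyOn φ Ψ Filter.atTop (Icc 0 T)) {I : ℝ → Euc d ⊗[ℝ] Euc n}
    (hI : IsIndefiniteIntegral x Ψ T Ψ x I) :
    TendstoUniformlyOn (fun k => leftRiemannSum (φ k) x (h k) (N k)) I Filter.atTop (Icc 0 T) := by
  rw [Metric.tendstoUniformlyOn_iff] at hφΨ ⊢
  intro ε hε
  have hM0 : 0 ≤ M := ENNReal.toReal_nonneg.trans hΨM
  set κ := ε / (3 * M + 2) with hκdef
  have hκ0 : 0 < κ := by positivity
  obtain ⟨δ, hδ, hxδ⟩ := hx.exists_forall_norm_sub_le hκ0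
  have hκ : ∀ η < δ, ∀ u ∈ Icc 0 T, ∀ v ∈ Icc 0 T, |u - v| ≤ η → ‖x u - x v‖ ≤ κ :=
    fun η hη u hu v hv huv => hxδ v hv u hu (huv.trans_lt hη)
  have hsmall := hh.eventually_lt_const hδ
  -- The index `m` fixes one grid: exchanging `φ k` for `Ψ` in a sum costs a factor `N m`, which
  -- must not grow with `k`. Then `k` is taken so large that the two paths are within `1 / (N m +
  -- 1)`.
  obtain ⟨m, hm⟩ := hsmall.exists
  filter_upwards [hsmall, hφΨ (1 / (N m + 1)) (by positivity)] with k hk hρ t ht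
  obtain ⟨J, hJ⟩ := exists_isIndefiniteIntegral_of_integrand hT.le (hφc k) hx (hφv k)
  have b1 := norm_leftRiemannSum_sub_integral_le (hh0 k) (hNh k) (hφv k) hJ (hκ _ hk) ht
  have b2 := norm_leftRiemannSum_sub_integral_le (hh0 m) (hNh m) (hφv k) hJ (hκ _ hm) ht
  have b3 := norm_leftRiemannSum_sub_integral_le (hh0 m) (hNh m) hΨv hI (hκ _ hm) ht
  have b4 := norm_leftRiemannSum_sub_leftRiemannSum_le (N := N m) (f := φ k) (g := Ψ) (hh0 m)
    (hκ _ hm) (ρ := 1 / (N m + 1)) (fun u hu => by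
      rw [← dist_eq_norm, dist_comm]; exact (hρ u hu).le) ht
  have b4' : (N m : ℝ) * (1 / (N m + 1) * κ) ≤ κ := by
    rw [← mul_assoc, mul_one_div]
    refine mul_le_of_le_one_left hκ0.le ?_
    rw [div_le_one (by positivity)]
    linarith
  have b5 : κ * (eVariationOn (φ k) (Icc 0 T)).toReal ≤ κ * M := by gcongr; exact hφM k
  have b6 : κ * (eVariationOn Ψ (Icc 0 T)).toReal ≤ κ * M := by gcongr
  -- Through the integral `J` of `φ k` to the fixed grid, then from `φ k` to `Ψ` there, then to `I`:
  -- three errors of at most `κ M` and one of at most `κ`, less than `ε = κ (3 M + 2)` in total.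
  have e : leftRiemannSum (φ k) x (h k) (N k) t - I t =
      (leftRiemannSum (φ k) x (h k) (N k) t - J t) -
      (leftRiemannSum (φ k) x (h m) (N m) t - J t) +
      (leftRiemannSum (φ k) x (h m) (N m) t - leftRiemannSum Ψ x (h m) (N m) t) +
      (leftRiemannSum Ψ x (h m) (N m) t - I t) := by abel
  rw [dist_comm, dist_eq_norm, e]
  have := (norm_add_le _ _).trans (add_le_add ((norm_add_le _ _).trans
    (add_le_add ((norm_sub_le _ _).trans (add_le_add b1 b2)) b4)) b3)
  have hεκ : ε = κ * (3 * M + 2) := by rw [hκdef]; field_simp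
  linarith

end Convergence

/-- If paths `w k` converge uniformly to `w` and the reflection terms have uniformly bounded
variation, then the reflection terms converge to that of `w`. -/
theorem IsSkorohodSolution.tendsto_of_tendstoUniformlyOn {d : ℕ} {D : Set (Euc d)} {T : ℝ}
    (hA : ConditionA D) {w ξ φ : ℝ → Euc d} {w' ξ' φ' : ℕ → ℝ → Euc d}
    (h : IsSkorohodSolution D T w ξ φ) (h' : ∀ k, IsSkorohodSolution D T (w' k) (ξ' k) (φ' k))
    {M : ℝ} (hM : ∀ k, (eVariationOn (φ' k) (Icc 0 T)).toReal ≤ M)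
    (hw : TendstoUniformlyOn w' w Filter.atTop (Icc 0 T)) {t : ℝ} (ht : t ∈ Icc 0 T) :
    Filter.Tendsto (fun k => φ' k t) Filter.atTop (nhds (φ t)) := by
  obtain ⟨r, hr, hAr⟩ := hA
  set E := Real.exp (2 / r * ((eVariationOn φ (Icc 0 T)).toReal + M)) with hE
  have hlim : Filter.Tendsto (fun ε : ℝ => (ε ^ 2 + r * ε) * E) (nhdsWithin 0 (Ioi 0))
      (nhds 0) := by
    have : Continuous fun ε : ℝ => (ε ^ 2 + r * ε) * E := by fun_prop
    have := this.tendsto 0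
    simp only [ne_eq, OfNat.ofNat_ne_zero, not_false_eq_true, zero_pow, mul_zero, add_zero,
      zero_mul] at this
    exact this.mono_left nhdsWithin_le_nhds
  rw [Metric.tendstoUniformlyOn_iff] at hw
  rw [Metric.tendsto_atTop']
  intro e he
  have he2 : 0 < e ^ 2 := by positivity
  obtain ⟨ε, hεe, hε⟩ := ((hlim.eventually_lt_const he2).and self_mem_nhdsWithin).exists
  have hε0 : 0 < ε := hε
  obtain ⟨K, hK⟩ := Filter.eventually_atTop.1 (hw ε hε0)
  refine ⟨K, fun k hk => ?_⟩
  have key := h.norm_sub_sq_le (h' k) hr (fun x hx => (hAr x hx).1) le_rfl hε0.le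
    (fun s hs => by rw [← dist_eq_norm]; exact (hK k hk.le s hs).le) t ht
  have hle : ‖φ t - φ' k t‖ ^ 2 < e ^ 2 := by
    refine key.trans_lt (lt_of_le_of_lt ?_ hεe)
    rw [hE]
    gcongr
    exact hM k
  rw [dist_comm, dist_eq_norm]
  exact lt_of_pow_lt_pow_left₀ 2 he.le hle

theorem exists_isImplicitSkorohodSolution_of_conditionH1 {d n : ℕ} {D : Set (Euc d)} {T : ℝ}
    {y₀ : Euc d} {η : ℝ → Euc d} {F : Euc d ⊗[ℝ] Euc n →ₗ[ℝ] Euc d} {x : ℝ → Euc n} (hT : 0 < T)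
    (hη : ContinuousOn η (Icc 0 T)) (hη₀ : η 0 = 0) (hy₀ : y₀ ∈ closure D)
    (hx : ContinuousOn x (Icc 0 T)) (hD : ConditionH1 D T) :
    ∃ y Φ : ℝ → Euc d, IsImplicitSkorohodSolution D T y₀ η F x y Φ := by
  obtain ⟨hA, hsol, C, hC0, hC⟩ := hD
  have hC0' : (0 : ℝ) < C := hC0
  obtain ⟨CF, hCF0, hCF⟩ := F.exists_pos_bound_of_finiteDimensional
  set h : ℕ → ℝ := fun k => T / (k + 1 : ℕ) with hhdef
  have hh0 : ∀ k, 0 ≤ h k := fun k => by positivity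
  have hNh : ∀ k, (k + 1 : ℕ) * h k = T := fun k => by
    simp only [hhdef]; field_simp
  have hhlim : Filter.Tendsto h Filter.atTop (nhds 0) :=
    (tendsto_const_div_atTop_nhds_zero_nat T).comp (Filter.tendsto_add_atTop_nat 1)
  choose ξ φ hS using fun k => exists_isSkorohodSolution_leftRiemannSum (F := F) hA hsol hη hη₀ hy₀
    hx (hh0 k) (hNh k)
  obtain ⟨M, hM⟩ : ∃ M : ℝ, ∀ k, (eVariationOn (φ k) (Icc 0 T)).toReal ≤ M := by
    -- This threshold is the one at which the absorption condition `4 C CF κ ≤ 1` holds with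
    -- equality.
    obtain ⟨δ₁, hδ₁, H₁⟩ := hx.exists_forall_norm_sub_le (ε := 1 / (4 * C * CF)) (by positivity)
    obtain ⟨δ₂, hδ₂, H₂⟩ := hη.exists_forall_norm_sub_le one_pos
    set δ := min δ₁ δ₂ / 2 with hδ
    have hδmin : 0 < min δ₁ δ₂ := lt_min hδ₁ hδ₂
    have hδ0 : 0 < δ := by positivity
    have hlt : δ < min δ₁ δ₂ := half_lt_self hδmin
    obtain ⟨m, hm⟩ := exists_nat_ge (T / δ)
    refine ⟨2 ^ m * (2 * C), fun k => toReal_eVariationOn_le_pow_of_leftRiemannSum hC hCF0.le hCF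
      (hh0 k) (hNh k) (hS k) hδ0 (κ := 1 / (4 * C * CF)) (le_of_eq (by field_simp))
      ((div_le_iff₀ hδ0).1 hm) ?_ ?_⟩
    · exact fun u hu v hv huv => H₁ v hv u hu (huv.trans_lt (hlt.trans_le (min_le_left _ _)))
    · exact fun u hu v hv huv => H₂ v hv u hu (huv.trans_lt (hlt.trans_le (min_le_right _ _)))
  have hM0 : 0 ≤ M := ENNReal.toReal_nonneg.trans (hM 0)
  have hbound : ∀ k, ∀ t ∈ Icc 0 T, ‖φ k t‖ ≤ M := by
    intro k t ht
    have h1 := (hS k).boundedVariation.norm_sub_le_toReal le_rfl ht.1 ht.2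
    rw [(hS k).term_zero hT.le, sub_zero] at h1
    exact h1.trans ((ENNReal.toReal_mono (hS k).boundedVariation
      (eVariationOn.mono _ (Icc_subset_Icc_right ht.2))).trans (hM k))
  have hequi : ∀ ε > 0, ∃ δ > 0, ∀ k, ∀ s t, 0 ≤ s → s ≤ t → t ≤ T → t - s < δ →
      ‖φ k t - φ k s‖ ≤ ε := by
    intro ε hε
    -- Half of `ε` is spent on `η` and half on the Riemann sum; the `+ 1` keeps the denominator
    -- positive if `M = 0`.
    obtain ⟨δ₁, hδ₁, H₁⟩ := hx.exists_forall_norm_sub_le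
      (ε := ε / (2 * C * (CF * (2 * M) + 1))) (by positivity)
    obtain ⟨δ₂, hδ₂, H₂⟩ := hη.exists_forall_norm_sub_le (ε := ε / (2 * C)) (by positivity)
    refine ⟨min δ₁ δ₂, lt_min hδ₁ hδ₂, fun k s t hs hst ht hlt => ?_⟩
    have hmem : ∀ u ∈ Icc s t, u ∈ Icc 0 T := fun u hu => ⟨hs.trans hu.1, hu.2.trans ht⟩
    have habs : ∀ u ∈ Icc s t, ∀ v ∈ Icc s t, |u - v| < min δ₁ δ₂ := fun u hu v hv => by
      rw [abs_lt]; constructor <;> linarith [hu.1, hu.2, hv.1, hv.2]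
    have h1 := toReal_eVariationOn_le_of_leftRiemannSum hC hCF0.le hCF (hh0 k) (hNh k) (hS k) hs
      hst ht
      (fun u hu v hv => H₁ v (hmem v hv) u (hmem u hu) ((habs u hu v hv).trans_le (min_le_left _ _)))
      (fun u hu v hv => H₂ v (hmem v hv) u (hmem u hu) ((habs u hu v hv).trans_le (min_le_right _ _)))
    have h2 : (eVariationOn (φ k) (Icc 0 t)).toReal ≤ M :=
      (ENNReal.toReal_mono (hS k).boundedVariation
        (eVariationOn.mono _ (Icc_subset_Icc_right ht))).trans (hM k)
    refine ((hS k).boundedVariation.norm_sub_le_toReal hs hst ht).trans (h1.trans ?_)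
    calc _ ≤ C * (ε / (2 * C) + CF * (2 * M * (ε / (2 * C * (CF * (2 * M) + 1))))) := by gcongr
      _ = ε / 2 + ε / 2 * (CF * (2 * M) / (CF * (2 * M) + 1)) := by field_simp
      _ ≤ ε / 2 + ε / 2 * 1 := by
        gcongr
        rw [div_le_one (by positivity)]
        linarith
      _ = ε := by ring
  obtain ⟨Ψ, σ, hσ, hΨc, hΨ⟩ := exists_subseq_tendstoUniformlyOn_Icc hT.le hbound hequi
  have hΨvar : eVariationOn Ψ (Icc 0 T) ≤ ENNReal.ofReal M :=
    eVariationOn_le_of_tendsto (fun t ht => hΨ.tendsto_at ht) fun k =>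
      (ENNReal.le_ofReal_iff_toReal_le (hS (σ k)).boundedVariation hM0).2 (hM (σ k))
  have hΨv : BoundedVariationOn Ψ (Icc 0 T) := ne_top_of_le_ne_top ENNReal.ofReal_ne_top hΨvar
  obtain ⟨I, hI⟩ := exists_isIndefiniteIntegral_of_integrand hT.le hΨc hx hΨv
  have hlim := tendstoUniformlyOn_leftRiemannSum hT hx (fun k => hNh (σ k))
    (hhlim.comp hσ.tendsto_atTop) (fun k => hh0 (σ k)) (fun k => (hS (σ k)).continuousOn_term)
    (fun k => (hS (σ k)).boundedVariation) (fun k => hM (σ k)) hΨv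
    (ENNReal.toReal_le_of_le_ofReal hM0 hΨvar) hΨ hI
  have hw : TendstoUniformlyOn
      (fun k t => y₀ + η t + F (leftRiemannSum (φ (σ k)) x (h (σ k)) (σ k + 1) t))
      (fun t => y₀ + η t + F (I t)) Filter.atTop (Icc 0 T) := by
    rw [Metric.tendstoUniformlyOn_iff] at hlim ⊢
    intro ε hε
    filter_upwards [hlim (ε / CF) (by positivity)] with k hk t ht
    have h1 := hk t ht
    rw [dist_eq_norm, lt_div_iff₀ hCF0] at h1
    rw [dist_add_left, dist_eq_norm, ← map_sub]
    exact (hCF _).trans_lt (by linarith)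
  obtain ⟨⟨ζ, Φ, hζ⟩, -⟩ := hsol (fun t => y₀ + η t + F (I t))
    ((continuousOn_const.add hη).add (F.continuous_of_finiteDimensional.comp_continuousOn
      (hI.continuousOn hΨv hx hΨc hx))) (by simpa [hη₀, hI.zero] using hy₀)
  -- The Euler terms tend to `Ψ` by compactness and to the reflection term of the limiting path by
  -- stability.
  have hΦΨ : EqOn Ψ Φ (Icc 0 T) := fun t ht =>
    tendsto_nhds_unique (hΨ.tendsto_at ht)
      (hζ.tendsto_of_tendstoUniformlyOn hA (fun k => hS (σ k)) (fun k => hM (σ k)) hw ht)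
  refine ⟨ζ, Φ, hζ.term_zero hT.le, I, fun t ht => ?_, hζ⟩
  exact (hI.hasYoungIntegral hΨv hx ht).congr (hΦΨ.mono (Icc_subset_Icc_right ht.2))

theorem lemma4p4 {d n : ℕ} (D : Set (Euc d)) (hD_open : IsOpen D) (hD_conn : IsConnected D)
    (T : ℝ) (hT : 0 < T)
    (y₀ : Euc d) (hy₀ : y₀ ∈ closure D)
    (η : ℝ → Euc d) (hη : ContinuousOn η (Icc 0 T)) (hη₀ : η 0 = 0)
    (p : ℝ) (hp : 1 ≤ p)
    (x : ℝ → Euc n) (hx : ContinuousOn x (Icc 0 T)) (hx₀ : x 0 = 0)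
    (hxp : HasFinitePVariation p x 0 T)
    (F : Euc d ⊗[ℝ] Euc n →ₗ[ℝ] Euc d) :
    (ConditionH2 D T → BoundedVariationOn x (Icc 0 T) →
      (∃ y Φ : ℝ → Euc d, IsImplicitSkorohodSolution D T y₀ η F x y Φ) ∧
      ∀ y Φ y' Φ' : ℝ → Euc d,
        IsImplicitSkorohodSolution D T y₀ η F x y Φ →
        IsImplicitSkorohodSolution D T y₀ η F x y' Φ' →
          EqOn y y' (Icc 0 T) ∧ EqOn Φ Φ' (Icc 0 T)) ∧
    (ConditionH1 D T →
      ∃ y Φ : ℝ → Euc d, IsImplicitSkorohodSolution D T y₀ η F x y Φ) :=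
  ⟨fun hH2 hv =>
    ⟨exists_isImplicitSkorohodSolution_of_boundedVariationOn hT.le hη hη₀ hy₀ hx hv hH2,
      fun _ _ _ _ h h' =>
        isImplicitSkorohodSolution_unique_of_boundedVariationOn hT.le hx hv hH2 h h'⟩,
    exists_isImplicitSkorohodSolution_of_conditionH1 hT hη hη₀ hy₀ hx⟩
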